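/- Let $\mathbb{H}$ be the quaternions and $\mathbb{B}=\{q\in\mathbb{H}: |q|<1\}$. A function $f:\mathbb{B}\to\mathbb{H}$ is (slice) regular if for every $I\in\mathbb{H}$ with $I^2=-1$ its restriction to $\mathbb{B}\cap(\mathbb{R}+I\mathbb{R})$ is real differentiable and satisfies $\frac12\left(\frac{\partial}{\partial x}+I\frac{\partial}{\partial y}\right)f(x+Iy)=0$; equivalently, $f(q)=\sum_{n\ge0}q^na_n$ on $\mathbb{B}$ with (unique) $a_n\in\mathbb{H}$. For regular $f=\sum q^na_n$, $g=\sum q^nb_n$ put $$f*g(q)=\sum_{n\ge0}q^n\sum_{k=0}^na_kb_{n-k},\qquad f^c(q)=\sum_{n\ge0}q^n\bar a_n,\qquad f^s=f*f^c,$$ and, where $f^s(q)\neq0$, $f^{-*}*g(q)=f^s(q)^{-1}\,(f^c*g)(q)$, $g*f^{-*}(q)=f^s(q)^{-1}\,(g*f^c)(q)$, $f^{-*}=f^{-*}*1$. In such expressions a quaternion stands for the constant function and $q$ for the variable. For $q_0\in\mathbb{B}$ let $\mathcal{M}_{q_0}(q)=(q-q_0)*(1-q\bar q_0)^{-*}$,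 and for regular $f:\mathbb{B}\to\mathbb{H}$ let $R_{q_0}f$ be the regular function on $\mathbb{B}$ that extends $(q-q_0)^{-*}*(f(q)-f(q_0))$. Write $x_0=\mathrm{Re}\,q_0$, $y_0=|\mathrm{Im}\,q_0|$, let $(R_{\bar q_0}R_{q_0})^k$ be the $k$-th iterate of the composition $R_{\bar q_0}R_{q_0}$, and let $$A_{2k}=(R_{\bar q_0}R_{q_0})^kf(q_0),\qquad A_{2k+1}=R_{q_0}(R_{\bar q_0}R_{q_0})^kf(\bar q_0)\qquad(k\ge0),$$ which are the coefficients of the spherical expansion $f(q)=\sum_{k\ge0}[(q-x_0)^2+y_0^2]^k\,[A_{2k}+(q-q_0)A_{2k+1}]$ of $f$ at $q_0$. **Theorem.** Let $f:\mathbb{B}\to\mathbb{B}$ be a regular function, let $q_0\in\mathbb{B}$ and let $n\ge1$ be an integer. If $A_m=0$ for all $1\le m\le 2n-1$, then for all $q\in\mathbb{B}$ $$\left|(f(q)-f(q_0))*(1-\overline{f(q_0)}*f(q))^{-*}\right|\le|\mathcal{M}^s_{q_0}(q)|^n,$$ $$\left|(R_{\bar q_0}R_{q_0})^nf(q)*(1-\overline{f(q_0)}*f(q))^{-*}\right|\le\left|(1-qx_0)^2+(qy_0)^2\right|^{-n}.$$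 If moreover $A_{2n}=0$, then for all $q\in\mathbb{B}$ $$\left|(f(q)-f(q_0))*(1-\overline{f(q_0)}*f(q))^{-*}\right|\le|\mathcal{M}^s_{q_0}(q)|^n\,|\mathcal{M}_{q_0}(q)|,$$ $$\left|R_{q_0}(R_{\bar q_0}R_{q_0})^nf(q)*(1-\overline{f(q_0)}*f(q))^{-*}\right|\le\left|(1-qx_0)^2+(qy_0)^2\right|^{-n}\cdot\left|(1-q\bar q_0)^{-*}\right|.$$ -/

import Mathlib

open scoped Quaternion

noncomputable section

namespace SliceRegularBall

/-- The open unit ball of the quaternions. -/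
def unitBall : Set ℍ[ℝ] := Metric.ball 0 1

/-- `f` is slice regular on the unit ball: for every imaginary unit `I`, the restriction of `f` to
the disc `{x + I y} ∩ 𝔹` is real differentiable and `½ (∂/∂x + I ∂/∂y) f (x + I y) = 0` there.
(Values of `f` outside the ball play no role.) -/
def SliceRegular (f : ℍ[ℝ] → ℍ[ℝ]) : Prop :=
  ∀ I : ℍ[ℝ], I ^ 2 = -1 → ∀ x y : ℝ, (x : ℍ[ℝ]) + I * (y : ℍ[ℝ]) ∈ unitBall →
    DifferentiableAt ℝ (fun p : ℝ × ℝ => f ((p.1 : ℍ[ℝ]) + I * (p.2 : ℍ[ℝ]))) (x, y) ∧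
    (1 / 2 : ℝ) • (deriv (fun s : ℝ => f ((s : ℍ[ℝ]) + I * (y : ℍ[ℝ]))) x
      + I * deriv (fun t : ℝ => f ((x : ℍ[ℝ]) + I * (t : ℍ[ℝ]))) y) = 0

/-- `f(q) = ∑ qⁿ aₙ` on the unit ball. -/
def HasPowerSeries (f : ℍ[ℝ] → ℍ[ℝ]) (a : ℕ → ℍ[ℝ]) : Prop :=
  ∀ q ∈ unitBall, HasSum (fun n : ℕ => q ^ n * a n) (f q)

open Classical in
/-- The coefficients of the power series of `f` on the unit ball
(they are unique; the value is `0` if `f` has no power series, i.e. is not slice regular). -/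
def coeff (f : ℍ[ℝ] → ℍ[ℝ]) : ℕ → ℍ[ℝ] :=
  if h : ∃ a, HasPowerSeries f a then h.choose else 0

/-- Regular multiplication: `f * g (q) = ∑ₙ qⁿ ∑_{k ≤ n} a_k b_{n-k}`. -/
def regMul (f g : ℍ[ℝ] → ℍ[ℝ]) (q : ℍ[ℝ]) : ℍ[ℝ] :=
  ∑' n : ℕ, q ^ n * ∑ k ∈ Finset.range (n + 1), coeff f k * coeff g (n - k)

/-- Regular conjugate: `f^c (q) = ∑ₙ qⁿ \bar aₙ`. -/
def regConj (f : ℍ[ℝ] → ℍ[ℝ]) (q : ℍ[ℝ]) : ℍ[ℝ] :=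
  ∑' n : ℕ, q ^ n * star (coeff f n)

/-- Symmetrization: `f^s = f * f^c`. -/
def symmetrization (f : ℍ[ℝ] → ℍ[ℝ]) : ℍ[ℝ] → ℍ[ℝ] :=
  regMul f (regConj f)

/-- Left regular quotient: `f^{-*} * g (q) = f^s(q)⁻¹ (f^c * g)(q)`, meaningful where
`f^s(q) ≠ 0`. -/
def leftQuot (f g : ℍ[ℝ] → ℍ[ℝ]) (q : ℍ[ℝ]) : ℍ[ℝ] :=
  (symmetrization f q)⁻¹ * regMul (regConj f) g q

/-- Right regular quotient: `g * h^{-*} (q) = h^s(q)⁻¹ (g * h^c)(q)`, meaningful where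
`h^s(q) ≠ 0`. -/
def rightQuot (g h : ℍ[ℝ] → ℍ[ℝ]) (q : ℍ[ℝ]) : ℍ[ℝ] :=
  (symmetrization h q)⁻¹ * regMul g (regConj h) q

/-- Regular reciprocal: `f^{-*} = f^{-*} * 1`. -/
def regRecip (f : ℍ[ℝ] → ℍ[ℝ]) : ℍ[ℝ] → ℍ[ℝ] :=
  leftQuot f (fun _ => 1)

/-- `g` is a slice regular function on the unit ball that coincides with the left regular quotient
`(q - q₀)^{-*} * (f(q) - f(q₀))` wherever the latter is defined, that is, off the zero set of
`(q - q₀)^s`. -/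
def IsDiffQuot (q₀ : ℍ[ℝ]) (f g : ℍ[ℝ] → ℍ[ℝ]) : Prop :=
  SliceRegular g ∧ ∀ q ∈ unitBall, symmetrization (fun p => p - q₀) q ≠ 0 →
    g q = leftQuot (fun p => p - q₀) (fun p => f p - f q₀) q

open Classical in
/-- The differential quotient `R_{q₀} f (q) = (q - q₀)^{-*} * (f(q) - f(q₀))`, as a slice regular
function on the whole unit ball (it exists and is unique on the ball when `f` is slice regular and
`q₀` is in the ball). -/
def diffQuot (q₀ : ℍ[ℝ]) (f : ℍ[ℝ] → ℍ[ℝ]) : ℍ[ℝ] → ℍ[ℝ] :=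
  if h : ∃ g, IsDiffQuot q₀ f g then h.choose else 0

/-- The iterates `(R_{\bar q₀} R_{q₀})ⁿ f`. -/
def iterDiffQuot (q₀ : ℍ[ℝ]) (n : ℕ) (f : ℍ[ℝ] → ℍ[ℝ]) : ℍ[ℝ] → ℍ[ℝ] :=
  (fun g => diffQuot (star q₀) (diffQuot q₀ g))^[n] f

/-- The coefficients of the spherical expansion
`f(q) = ∑ₖ [(q - x₀)² + y₀²]ᵏ [A_{2k} + (q - q₀) A_{2k+1}]`, namely
`A_{2k} = (R_{\bar q₀} R_{q₀})ᵏ f (q₀)` and `A_{2k+1} = R_{q₀} (R_{\bar q₀} R_{q₀})ᵏ f (\bar q₀)`. -/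
def sphericalCoeff (f : ℍ[ℝ] → ℍ[ℝ]) (q₀ : ℍ[ℝ]) (m : ℕ) : ℍ[ℝ] :=
  if Even m then iterDiffQuot q₀ (m / 2) f q₀
  else diffQuot q₀ (iterDiffQuot q₀ (m / 2) f) (star q₀)

/-- The regular Möbius transformation `𝓜_{q₀}(q) = (q - q₀) * (1 - q \bar q₀)^{-*}`. -/
def mobius (q₀ : ℍ[ℝ]) : ℍ[ℝ] → ℍ[ℝ] :=
  rightQuot (fun q => q - q₀) (fun q => 1 - q * star q₀)

/-- The function `1 - \overline{f(q₀)} * f(q)`, with the regular product. -/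
def schwarzDenom (f : ℍ[ℝ] → ℍ[ℝ]) (q₀ : ℍ[ℝ]) (q : ℍ[ℝ]) : ℍ[ℝ] :=
  1 - regMul (fun _ => star (f q₀)) f q

end SliceRegularBall

end

open SliceRegularBall

/-! Since `X` is central in `PowerSeries ℍ[ℝ]`, the regular product is the ordinary product of power
series, so everything reduces to series and their values. Values are not multiplicative, but (φ *
ψ)(q) = φ(q) ψ(φ(q)⁻¹ q φ(q)) when φ(q) ≠ 0 (`ev_mul`), and the conjugated point has the norm of q.
Hence bounds on spheres about 0 pass to products (`norm_ev_mul_le`) and to quotients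
(`norm_ev_le_of_mul_eq`). Series with real coefficients, such as symmetrizations, are central and
evaluate multiplicatively. Complex analysis enters slice by slice, through ℍ as a complex Banach
space.

Put c = f(q₀), S = (q - q₀)^s, T = (1 - q q̄₀)^s and η = (1 - c̄ * f)^{-*}. The vanishing
coefficients give f - c = Sⁿ * Φ with Φ the iterated quotient (`Rep.iterDiffQuot`), and the Möbius
transform (f - c) * η is bounded by 1 (`exists_inverse_norm_le`). The Schwarz step
`norm_ev_reflFactor_mul_le` says that if (q - q₀) * χ is bounded by 1, so is (1 - q q̄₀) * χ: near
the boundary |1 - u q̄₀| ≤ (1 + o(1)) |u - q₀|, and the maximum modulus principle does the rest.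
Using it 2n times gives |Tⁿ * Φ * η| ≤ 1. This is the second estimate, and multiplication by |S/T|ⁿ
= |𝓜^s|ⁿ gives the first.

If A_{2n} = 0, then Φ = (q - q₀) * Ψ and the Schwarz step applies once more; multiplying on the left
by 𝓜 or by (1 - q q̄₀)^{-*} gives the last two estimates. -/

noncomputable section

namespace SliceRegularBall

/-! ### Power series converging on the ball -/

/-- The power series `φ` converges absolutely on the open unit ball. -/
def Conv (φ : PowerSeries ℍ[ℝ]) : Prop :=
  ∀ r : ℝ, 0 ≤ r → r < 1 → Summable fun n => ‖PowerSeries.coeff n φ‖ * r ^ n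

/-- Evaluation `∑ qⁿ aₙ` of a power series with coefficients on the right. -/
def ev (φ : PowerSeries ℍ[ℝ]) (q : ℍ[ℝ]) : ℍ[ℝ] :=
  ∑' n : ℕ, q ^ n * PowerSeries.coeff n φ

/-- Coefficientwise conjugation of a power series. -/
def conj (φ : PowerSeries ℍ[ℝ]) : PowerSeries ℍ[ℝ] :=
  PowerSeries.mk fun n => star (PowerSeries.coeff n φ)

@[simp] lemma coeff_conj (φ : PowerSeries ℍ[ℝ]) (n : ℕ) :
    PowerSeries.coeff n (conj φ) = star (PowerSeries.coeff n φ) := by simp [conj]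

lemma mem_unitBall {q : ℍ[ℝ]} : q ∈ unitBall ↔ ‖q‖ < 1 := by simp [unitBall]

lemma Conv.summable_norm {φ : PowerSeries ℍ[ℝ]} (h : Conv φ) {q : ℍ[ℝ]} (hq : ‖q‖ < 1) :
    Summable fun n : ℕ => ‖q ^ n * PowerSeries.coeff n φ‖ := by
  simpa [mul_comm] using h _ (norm_nonneg q) hq

lemma Conv.hasSum {φ : PowerSeries ℍ[ℝ]} (h : Conv φ) {q : ℍ[ℝ]} (hq : ‖q‖ < 1) :
    HasSum (fun n : ℕ => q ^ n * PowerSeries.coeff n φ) (ev φ q) :=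
  (h.summable_norm hq).of_norm.hasSum

/-- Boundedness of the terms at every radius suffices for convergence (Abel). -/
lemma Conv.of_bounded {φ : PowerSeries ℍ[ℝ]}
    (h : ∀ r : ℝ, 0 < r → r < 1 → ∃ M, ∀ n, ‖PowerSeries.coeff n φ‖ * r ^ n ≤ M) : Conv φ := by
  intro r hr0 hr1
  obtain ⟨M, hM⟩ := h ((1 + r) / 2) (by linarith) (by linarith)
  have hs : (0 : ℝ) < (1 + r) / 2 := by linarith
  have hlt : r / ((1 + r) / 2) < 1 := by rw [div_lt_one hs]; linarith
  refine Summable.of_nonneg_of_le (fun n => by positivity) (fun n => ?_)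
    ((summable_geometric_of_lt_one (by positivity) hlt).mul_left M)
  have : r ^ n = ((1 + r) / 2) ^ n * (r / ((1 + r) / 2)) ^ n := by
    rw [← mul_pow, mul_div_cancel₀ _ hs.ne']
  rw [this, ← mul_assoc]
  exact mul_le_mul_of_nonneg_right (hM n) (by positivity)

lemma Conv.of_summable {φ : PowerSeries ℍ[ℝ]}
    (h : ∀ x : ℝ, 0 < x → x < 1 →
      Summable fun n : ℕ => (x : ℍ[ℝ]) ^ n * PowerSeries.coeff n φ) : Conv φ := by
  refine Conv.of_bounded fun r h0 h1 => ?_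
  obtain ⟨M, hM⟩ := (h r h0 h1).tendsto_atTop_zero.norm.bddAbove_range
  refine ⟨M, fun n => ?_⟩
  have := hM ⟨n, rfl⟩
  simpa [mul_comm, abs_of_pos h0] using this

lemma Conv.add {φ ψ : PowerSeries ℍ[ℝ]} (h : Conv φ) (h' : Conv ψ) : Conv (φ + ψ) := by
  intro r h0 h1
  refine Summable.of_nonneg_of_le (fun n => by positivity) (fun n => ?_)
    ((h r h0 h1).add (h' r h0 h1))
  rw [← add_mul, map_add]
  exact mul_le_mul_of_nonneg_right (norm_add_le _ _) (by positivity)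

lemma Conv.neg {φ : PowerSeries ℍ[ℝ]} (h : Conv φ) : Conv (-φ) := by
  intro r h0 h1
  simpa using h r h0 h1

lemma Conv.sub {φ ψ : PowerSeries ℍ[ℝ]} (h : Conv φ) (h' : Conv ψ) : Conv (φ - ψ) := by
  rw [sub_eq_add_neg]; exact h.add h'.neg

lemma Conv.conj {φ : PowerSeries ℍ[ℝ]} (h : Conv φ) : Conv (conj φ) := by
  intro r h0 h1
  simpa using h r h0 h1

lemma conv_C (a : ℍ[ℝ]) : Conv (PowerSeries.C a) := by
  intro r h0 h1
  refine summable_of_ne_finset_zero (s := {0}) fun n hn => ?_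
  simp only [Finset.mem_singleton] at hn
  simp [PowerSeries.coeff_C, hn]

lemma conv_X : Conv PowerSeries.X := by
  intro r h0 h1
  refine summable_of_ne_finset_zero (s := {1}) fun n hn => ?_
  simp only [Finset.mem_singleton] at hn
  simp [PowerSeries.coeff_X, hn]

lemma conv_one : Conv 1 := by
  simpa using conv_C 1

lemma Conv.mul {φ ψ : PowerSeries ℍ[ℝ]} (h : Conv φ) (h' : Conv ψ) : Conv (φ * ψ) := by
  intro r h0 h1
  refine Summable.of_nonneg_of_le (fun n => by positivity) (fun n => ?_)
    (summable_norm_sum_mul_antidiagonal_of_summable_norm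
      (f := fun n => ‖PowerSeries.coeff n φ‖ * r ^ n)
      (g := fun n => ‖PowerSeries.coeff n ψ‖ * r ^ n)
      (h r h0 h1).norm (h' r h0 h1).norm)
  rw [PowerSeries.coeff_mul, Real.norm_of_nonneg (Finset.sum_nonneg fun _ _ => by positivity)]
  refine (mul_le_mul_of_nonneg_right (norm_sum_le _ _) (by positivity)).trans ?_
  rw [Finset.sum_mul]
  refine Finset.sum_le_sum fun p hp => ?_
  rw [Finset.HasAntidiagonal.mem_antidiagonal] at hp
  rw [norm_mul, ← hp, pow_add]
  exact le_of_eq (by ring)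

lemma Conv.pow {φ : PowerSeries ℍ[ℝ]} (h : Conv φ) (n : ℕ) : Conv (φ ^ n) := by
  induction n with
  | zero => simpa using conv_one
  | succ n ih => rw [pow_succ]; exact ih.mul h

lemma ev_add {φ ψ : PowerSeries ℍ[ℝ]} (h : Conv φ) (h' : Conv ψ) {q : ℍ[ℝ]} (hq : ‖q‖ < 1) :
    ev (φ + ψ) q = ev φ q + ev ψ q := by
  refine HasSum.tsum_eq ?_
  simpa [mul_add] using (h.hasSum hq).add (h'.hasSum hq)

lemma ev_sub {φ ψ : PowerSeries ℍ[ℝ]} (h : Conv φ) (h' : Conv ψ) {q : ℍ[ℝ]} (hq : ‖q‖ < 1) :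
    ev (φ - ψ) q = ev φ q - ev ψ q := by
  refine HasSum.tsum_eq ?_
  simpa [mul_sub] using (h.hasSum hq).sub (h'.hasSum hq)

@[simp] lemma ev_C (a q : ℍ[ℝ]) : ev (PowerSeries.C a) q = a := by
  rw [ev, tsum_eq_single 0 fun n hn => by simp [PowerSeries.coeff_C, hn]]
  simp

@[simp] lemma ev_one (q : ℍ[ℝ]) : ev 1 q = 1 := by
  simpa using ev_C 1 q

@[simp] lemma ev_X (q : ℍ[ℝ]) : ev PowerSeries.X q = q := by
  rw [ev, tsum_eq_single 1 fun n hn => by simp [PowerSeries.coeff_X, hn]]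
  simp

/-! ### Values of regular products -/

lemma tsum_antidiagonal {F : ℕ × ℕ → ℍ[ℝ]} (hF : Summable F) :
    ∑' n : ℕ, ∑ p ∈ Finset.HasAntidiagonal.antidiagonal n, F p = ∑' m : ℕ, ∑' k : ℕ, F (k, m) := by
  have h1 : HasSum (fun n : ℕ => ∑ p ∈ Finset.HasAntidiagonal.antidiagonal n, F p)
      (∑' p, F p) := by
    have h2 := (Equiv.hasSum_iff (Finset.HasAntidiagonal.sigmaAntidiagonalEquivProd (A := ℕ))
      (f := F)).mpr hF.hasSum
    refine h2.sigma fun n => ?_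
    rw [← Finset.sum_coe_sort]
    exact hasSum_fintype _
  have h3 : HasSum (fun c : ℕ × ℕ => F c.swap) (∑' p, F p) :=
    (Equiv.hasSum_iff (Equiv.prodComm ℕ ℕ) (f := F)).mpr hF.hasSum
  rw [h1.tsum_eq, ← h3.tsum_eq]
  exact h3.summable.tsum_prod

/-- The regular product as a series in which the value of the left factor is inserted. -/
lemma ev_mul_eq_tsum {φ ψ : PowerSeries ℍ[ℝ]} (h : Conv φ) (h' : Conv ψ) {q : ℍ[ℝ]}
    (hq : ‖q‖ < 1) :
    ev (φ * ψ) q = ∑' n : ℕ, q ^ n * ev φ q * PowerSeries.coeff n ψ := by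
  have hF : Summable fun p : ℕ × ℕ =>
      q ^ p.2 * (q ^ p.1 * PowerSeries.coeff p.1 φ) * PowerSeries.coeff p.2 ψ := by
    refine Summable.of_norm ?_
    refine ((h.summable_norm hq).mul_norm (h'.summable_norm hq)).congr fun p => ?_
    simp only [norm_mul]; ring
  -- The inner sum runs over the index of the left factor, so it collapses to `ev φ q`.
  refine Eq.trans ?_ ((tsum_antidiagonal hF).trans ?_)
  · refine tsum_congr fun n => ?_
    rw [PowerSeries.coeff_mul, Finset.mul_sum]
    refine Finset.sum_congr rfl fun p hp => ?_
    rw [Finset.HasAntidiagonal.mem_antidiagonal] at hp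
    rw [← hp, add_comm, pow_add]
    simp only [mul_assoc]
  · refine tsum_congr fun n => ?_
    dsimp only
    rw [tsum_mul_right, tsum_mul_left]
    rfl

lemma norm_inv_mul_mul {v q : ℍ[ℝ]} (hv : v ≠ 0) : ‖v⁻¹ * q * v‖ = ‖q‖ := by
  have : ‖v‖ ≠ 0 := norm_ne_zero_iff.mpr hv
  rw [norm_mul, norm_mul, norm_inv]; field_simp

lemma inv_mul_mul_pow {v : ℍ[ℝ]} (hv : v ≠ 0) (q : ℍ[ℝ]) (n : ℕ) :
    (v⁻¹ * q * v) ^ n = v⁻¹ * q ^ n * v := by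
  induction n with
  | zero => simp [hv]
  | succ n ih =>
    rw [pow_succ, ih, pow_succ]
    simp only [mul_assoc]
    rw [mul_inv_cancel_left₀ hv]

lemma ev_mul_of_eq_zero {φ ψ : PowerSeries ℍ[ℝ]} (h : Conv φ) (h' : Conv ψ) {q : ℍ[ℝ]}
    (hq : ‖q‖ < 1) (h0 : ev φ q = 0) : ev (φ * ψ) q = 0 := by
  simp [ev_mul_eq_tsum h h' hq, h0]

/-- With v = φ(q), the identity qⁿ v = v (v⁻¹ q v)ⁿ moves v out to the left of the whole series of
ψ. -/
lemma ev_mul {φ ψ : PowerSeries ℍ[ℝ]} (h : Conv φ) (h' : Conv ψ) {q : ℍ[ℝ]}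
    (hq : ‖q‖ < 1) (h0 : ev φ q ≠ 0) :
    ev (φ * ψ) q = ev φ q * ev ψ ((ev φ q)⁻¹ * q * ev φ q) := by
  rw [ev_mul_eq_tsum h h' hq, ev.eq_def ψ, ← tsum_mul_left]
  refine tsum_congr fun n => ?_
  have : ((ev φ q)⁻¹ * q * ev φ q) ^ n = (ev φ q)⁻¹ * q ^ n * ev φ q :=
    inv_mul_mul_pow h0 q n
  rw [this]
  simp only [← mul_assoc, mul_inv_cancel₀ h0, one_mul]

lemma ev_mul_of_commute {φ ψ : PowerSeries ℍ[ℝ]} (h : Conv φ) (h' : Conv ψ) {q : ℍ[ℝ]}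
    (hq : ‖q‖ < 1) (hc : Commute q (ev φ q)) : ev (φ * ψ) q = ev φ q * ev ψ q := by
  rw [ev_mul_eq_tsum h h' hq, ev.eq_def ψ, ← tsum_mul_left]
  refine tsum_congr fun n => ?_
  rw [(hc.pow_left n).eq, mul_assoc]

/-- The right factor is evaluated at an unknown conjugate of q, so its bound is required on the
whole sphere through q. -/
lemma norm_ev_mul_le {φ ψ : PowerSeries ℍ[ℝ]} (h : Conv φ) (h' : Conv ψ) {q : ℍ[ℝ]}
    (hq : ‖q‖ < 1) {M : ℝ} (hM : ∀ u, ‖u‖ = ‖q‖ → ‖ev ψ u‖ ≤ M) :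
    ‖ev (φ * ψ) q‖ ≤ ‖ev φ q‖ * M := by
  by_cases h0 : ev φ q = 0
  · simp [ev_mul_of_eq_zero h h' hq h0, h0]
  · rw [ev_mul h h' hq h0, norm_mul]
    exact mul_le_mul_of_nonneg_left (hM _ (norm_inv_mul_mul h0)) (norm_nonneg _)

/-! ### Regular conjugation, real series and symmetrizations -/

/-- Power series with real coefficients. -/
def IsReal (σ : PowerSeries ℍ[ℝ]) : Prop := conj σ = σ

lemma conj_add (φ ψ : PowerSeries ℍ[ℝ]) : conj (φ + ψ) = conj φ + conj ψ := by
  ext1 n; simp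

lemma conj_sub (φ ψ : PowerSeries ℍ[ℝ]) : conj (φ - ψ) = conj φ - conj ψ := by
  ext1 n; simp

@[simp] lemma conj_conj (φ : PowerSeries ℍ[ℝ]) : conj (conj φ) = φ := by
  ext1 n; simp

lemma conj_mul (φ ψ : PowerSeries ℍ[ℝ]) : conj (φ * ψ) = conj ψ * conj φ := by
  ext1 n
  rw [coeff_conj, PowerSeries.coeff_mul, PowerSeries.coeff_mul, star_sum,
    ← Finset.Nat.sum_antidiagonal_swap]
  exact Finset.sum_congr rfl fun p _ => by simp

@[simp] lemma conj_C (a : ℍ[ℝ]) : conj (PowerSeries.C a) = PowerSeries.C (star a) := by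
  ext1 n; simp only [coeff_conj, PowerSeries.coeff_C]; split_ifs <;> simp

@[simp] lemma conj_one : conj 1 = 1 := by
  simpa using conj_C 1

@[simp] lemma conj_X : conj PowerSeries.X = PowerSeries.X := by
  ext1 n; simp only [coeff_conj, PowerSeries.coeff_X]; split_ifs <;> simp

lemma IsReal.exists_coeff {σ : PowerSeries ℍ[ℝ]} (h : IsReal σ) (n : ℕ) :
    ∃ x : ℝ, PowerSeries.coeff n σ = x := by
  refine ⟨(PowerSeries.coeff n σ).re, ?_⟩
  have : star (PowerSeries.coeff n σ) = PowerSeries.coeff n σ := by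
    rw [← coeff_conj, h]
  exact (Quaternion.star_eq_self.mp this)

lemma IsReal.commute {σ : PowerSeries ℍ[ℝ]} (h : IsReal σ) (φ : PowerSeries ℍ[ℝ]) :
    Commute σ φ := by
  ext1 n
  rw [PowerSeries.coeff_mul, PowerSeries.coeff_mul, ← Finset.Nat.sum_antidiagonal_swap]
  refine Finset.sum_congr rfl fun p _ => ?_
  obtain ⟨x, hx⟩ := h.exists_coeff p.swap.1
  rw [hx, Quaternion.coe_commutes]
  rw [← hx]; rfl

lemma IsReal.commute_ev {σ : PowerSeries ℍ[ℝ]} (h : IsReal σ) (q : ℍ[ℝ]) :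
    Commute q (ev σ q) := by
  refine Commute.tsum_right q fun n => ?_
  obtain ⟨x, hx⟩ := h.exists_coeff n
  rw [hx]
  exact ((Commute.refl q).pow_right n).mul_right (Quaternion.coe_commutes x q).symm

lemma IsReal.ev_mul {σ ψ : PowerSeries ℍ[ℝ]} (hσ : IsReal σ) (h : Conv σ) (h' : Conv ψ)
    {q : ℍ[ℝ]} (hq : ‖q‖ < 1) : ev (σ * ψ) q = ev σ q * ev ψ q :=
  ev_mul_of_commute h h' hq (hσ.commute_ev q)

lemma isReal_mul_conj (φ : PowerSeries ℍ[ℝ]) : IsReal (φ * conj φ) := by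
  simp [IsReal, conj_mul]

lemma IsReal.one : IsReal 1 := conj_one

lemma IsReal.mul {σ τ : PowerSeries ℍ[ℝ]} (h : IsReal σ) (h' : IsReal τ) : IsReal (σ * τ) := by
  rw [IsReal, conj_mul, h, h', (h.commute τ).eq]

lemma IsReal.pow {σ : PowerSeries ℍ[ℝ]} (h : IsReal σ) (n : ℕ) : IsReal (σ ^ n) := by
  induction n with
  | zero => simpa using IsReal.one
  | succ n ih => rw [pow_succ]; exact ih.mul h

lemma IsReal.ev_pow {σ : PowerSeries ℍ[ℝ]} (hσ : IsReal σ) (h : Conv σ) {q : ℍ[ℝ]}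
    (hq : ‖q‖ < 1) (n : ℕ) : ev (σ ^ n) q = ev σ q ^ n := by
  induction n with
  | zero => simp
  | succ n ih => rw [pow_succ', pow_succ', hσ.ev_mul h (h.pow n) hq, ih]

/-- The sum φ + φ^c has real coefficients, hence commutes with φ; cancelling φ² leaves the claim. -/
lemma conj_mul_self (φ : PowerSeries ℍ[ℝ]) : conj φ * φ = φ * conj φ := by
  have ht : IsReal (φ + conj φ) := by simp [IsReal, conj_add, add_comm]
  have := (ht.commute φ).eq
  rw [add_mul, mul_add] at this
  exact add_left_cancel this

/-- If `a * b = g`, then bounds of `g` in terms of `a` on the sphere through `q` bound `b`. -/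
lemma norm_ev_le_of_mul_eq {a b g : PowerSeries ℍ[ℝ]} (ha : Conv a) (hb : Conv b)
    (hg : Conv g) (e : a * b = g) {q : ℍ[ℝ]} (hq : ‖q‖ < 1) (h0 : ev (a * conj a) q ≠ 0) {M : ℝ}
    (hM : ∀ u, ‖u‖ = ‖q‖ → ‖ev g u‖ ≤ M * ‖ev a u‖) : ‖ev b q‖ ≤ M := by
  have h1 : ev (conj a) q ≠ 0 := fun h => h0 <| by
    rw [← conj_mul_self]; exact ev_mul_of_eq_zero ha.conj ha hq h
  -- Both a^s = a^c * a and a^c * g have the left factor a^c, so a and g are evaluated at the same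
  -- conjugate of q, where `hM` compares them.
  have e1 : a * conj a * b = conj a * g := by rw [← conj_mul_self, mul_assoc, e]
  have e2 := congrArg (fun φ : PowerSeries ℍ[ℝ] => ‖ev φ q‖) e1
  simp only [(isReal_mul_conj a).ev_mul (ha.mul ha.conj) hb hq, ev_mul ha.conj hg hq h1,
    norm_mul] at e2
  have e3 : ‖ev (a * conj a) q‖ =
      ‖ev (conj a) q‖ * ‖ev a ((ev (conj a) q)⁻¹ * q * ev (conj a) q)‖ := by
    rw [← conj_mul_self, ev_mul ha.conj ha hq h1, norm_mul]
  have h3 := hM _ (norm_inv_mul_mul (q := q) h1)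
  have hpos : 0 < ‖ev (a * conj a) q‖ := norm_pos_iff.mpr h0
  refine le_of_mul_le_mul_left ?_ hpos
  rw [e2, e3]
  refine (mul_le_mul_of_nonneg_left h3 (norm_nonneg (ev (conj a) q))).trans (le_of_eq ?_)
  ring

/-! ### Complex analysis on slices -/

/-- The embedding `x + i y ↦ x + I y` of `ℂ` given by an imaginary unit. -/
def sliceEmb {I : ℍ[ℝ]} (hI : I ^ 2 = -1) : ℂ →ₐ[ℝ] ℍ[ℝ] :=
  Complex.liftAux I (by rw [← sq, hI])

lemma sliceEmb_apply {I : ℍ[ℝ]} (hI : I ^ 2 = -1) (z : ℂ) :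
    sliceEmb hI z = (z.re : ℍ[ℝ]) + I * (z.im : ℍ[ℝ]) := by
  rw [sliceEmb, Complex.liftAux_apply, ← Quaternion.coe_commutes, Quaternion.coe_mul_eq_smul]
  rfl

/-- The image of i squares to -1, so it has norm 1 and is skew under conjugation. Hence ι respects
conjugation, and z z̄ = |z|² is carried over. -/
lemma norm_algHom (ι : ℂ →ₐ[ℝ] ℍ[ℝ]) (z : ℂ) : ‖ι z‖ = ‖z‖ := by
  have hI2 : ι Complex.I * ι Complex.I = -1 := by
    rw [← map_mul, Complex.I_mul_I, map_neg, map_one]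
  have hn : ‖ι Complex.I‖ = 1 := by
    have := congrArg norm hI2
    rw [norm_mul, norm_neg, norm_one] at this
    nlinarith [norm_nonneg (ι Complex.I)]
  have hs : star (ι Complex.I) = -ι Complex.I := by
    have h0 : ι Complex.I ≠ 0 := norm_ne_zero_iff.mp (by rw [hn]; norm_num)
    apply mul_left_cancel₀ h0
    rw [Quaternion.self_mul_star, Quaternion.normSq_eq_norm_mul_self, hn, mul_neg, hI2]
    simp
  have hstar : star (ι z) = ι (star z) := by
    have e : ∀ w : ℂ, ι w = algebraMap ℝ ℍ[ℝ] w.re + w.im • ι Complex.I := fun w => by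
      conv_lhs => rw [← Complex.re_add_im w]
      rw [map_add, mul_comm _ Complex.I, mul_comm Complex.I, ← Complex.real_smul, map_smul]
      congr 1
      exact ι.commutes w.re
    rw [e z, e (star z)]
    simp [hs, Quaternion.algebraMap_def]
  have h := Quaternion.self_mul_star (ι z)
  rw [hstar, ← map_mul, Quaternion.normSq_eq_norm_mul_self] at h
  have e2 : z * star z = ((‖z‖ * ‖z‖ : ℝ) : ℂ) := by
    rw [← sq, ← Complex.normSq_eq_norm_sq]; exact Complex.mul_conj z
  rw [e2] at h
  have e3 : ι ((‖z‖ * ‖z‖ : ℝ) : ℂ) = ((‖z‖ * ‖z‖ : ℝ) : ℍ[ℝ]) := ι.commutes _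
  rw [e3, Quaternion.coe_inj] at h
  exact ((mul_self_inj (norm_nonneg _) (norm_nonneg _)).mp h).symm

/-- The left complex structure on the quaternions given by an embedding of `ℂ`. -/
@[reducible] def sliceSpace (ι : ℂ →ₐ[ℝ] ℍ[ℝ]) : NormedSpace ℂ ℍ[ℝ] where
  toModule := Module.compHom ℍ[ℝ] ι.toRingHom
  norm_smul_le a b := by
    change ‖ι a * b‖ ≤ _
    rw [norm_mul, norm_algHom]

lemma sliceSpace_smul (ι : ℂ →ₐ[ℝ] ℍ[ℝ]) (z : ℂ) (q : ℍ[ℝ]) :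
    letI := sliceSpace ι; z • q = ι z * q := rfl

lemma sliceSpace_tower (ι : ℂ →ₐ[ℝ] ℍ[ℝ]) :
    letI := sliceSpace ι; IsScalarTower ℝ ℂ ℍ[ℝ] := by
  let := sliceSpace ι
  refine ⟨fun x z q => ?_⟩
  rw [sliceSpace_smul, sliceSpace_smul, map_smul, smul_mul_assoc]

/-- The coefficients stand on the right of the powers, so on a slice the series is a complex power
series with vector coefficients for the left complex structure. -/
lemma differentiableOn_ev (ι : ℂ →ₐ[ℝ] ℍ[ℝ]) {φ : PowerSeries ℍ[ℝ]} (h : Conv φ) :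
    letI := sliceSpace ι
    DifferentiableOn ℂ (fun z => ev φ (ι z)) (Metric.ball (0 : ℂ) 1) := by
  let := sliceSpace ι
  intro z hz
  rw [mem_ball_zero_iff] at hz
  obtain ⟨r, hr, hr1⟩ := exists_between hz
  have key : DifferentiableOn ℂ (fun w : ℂ => ∑' n : ℕ, w ^ n • PowerSeries.coeff n φ)
      (Metric.ball (0 : ℂ) r) := by
    refine Complex.differentiableOn_tsum_of_summable_norm
      (h r ((norm_nonneg z).trans hr.le) hr1) (fun n => ?_) Metric.isOpen_ball fun n w hw => ?_
    · exact ((differentiable_id.pow n).smul_const _).differentiableOn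
    · rw [mem_ball_zero_iff] at hw
      rw [norm_smul, norm_pow, mul_comm]
      gcongr
  have : (fun z => ev φ (ι z)) = fun w : ℂ => ∑' n : ℕ, w ^ n • PowerSeries.coeff n φ := by
    funext w
    simp only [ev, sliceSpace_smul, map_pow]
  rw [this]
  exact (key.differentiableAt
    (Metric.isOpen_ball.mem_nhds (mem_ball_zero_iff.mpr hr))).differentiableWithinAt

lemma exists_slice (q : ℍ[ℝ]) : ∃ (I : ℍ[ℝ]) (hI : I ^ 2 = -1) (z : ℂ), sliceEmb hI z = q := by
  by_cases h : q.im = 0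
  -- A real quaternion lies on every slice, so any imaginary unit serves.
  · obtain ⟨I, hI⟩ : ∃ I : ℍ[ℝ], I ^ 2 = -1 :=
      ⟨Quaternion.coeComplex Complex.I, by
        rw [sq, ← Quaternion.coeComplex_mul, Complex.I_mul_I]; ext <;> simp⟩
    refine ⟨I, hI, (q.re : ℂ), ?_⟩
    rw [sliceEmb_apply]
    conv_rhs => rw [← Quaternion.re_add_im q, h]
    simp
  · have hn : ‖q.im‖ ≠ 0 := norm_ne_zero_iff.mpr h
    have hI : ((‖q.im‖⁻¹ : ℝ) • q.im) ^ 2 = -1 := by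
      have : q.im ^ 2 = -((‖q.im‖ * ‖q.im‖ : ℝ) : ℍ[ℝ]) := by
        rw [← Quaternion.normSq_eq_norm_mul_self]
        exact Quaternion.im_sq q
      rw [smul_pow, this, smul_neg, ← Quaternion.coe_smul, smul_eq_mul]
      field_simp
      simp
    refine ⟨_, hI, ⟨q.re, ‖q.im‖⟩, ?_⟩
    rw [sliceEmb_apply, ← Quaternion.coe_commutes, Quaternion.coe_mul_eq_smul, smul_smul,
      mul_inv_cancel₀ hn, one_smul, Quaternion.re_add_im]

/-- Maximum modulus principle. -/
lemma norm_ev_le_of_sphere {φ : PowerSeries ℍ[ℝ]} (h : Conv φ) {ρ M : ℝ} (hρ : ρ < 1)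
    (hM : ∀ u, ‖u‖ = ρ → ‖ev φ u‖ ≤ M) {q : ℍ[ℝ]} (hq : ‖q‖ < ρ) : ‖ev φ q‖ ≤ M := by
  obtain ⟨I, hI, z, rfl⟩ := exists_slice q
  let := sliceSpace (sliceEmb hI)
  rw [norm_algHom] at hq
  have hρ0 : ρ ≠ 0 := ((norm_nonneg z).trans_lt hq).ne'
  have hd : DiffContOnCl ℂ (fun z => ev φ (sliceEmb hI z)) (Metric.ball (0 : ℂ) ρ) := by
    refine (DifferentiableOn.mono (differentiableOn_ev (sliceEmb hI) h) ?_).diffContOnCl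
    rw [closure_ball _ hρ0]
    exact Metric.closedBall_subset_ball hρ
  refine Complex.norm_le_of_forall_mem_frontier_norm_le Metric.isBounded_ball hd (fun w hw => ?_)
    (subset_closure (mem_ball_zero_iff.mpr hq))
  rw [frontier_ball _ hρ0, mem_sphere_zero_iff_norm] at hw
  exact hM _ (by rw [norm_algHom, hw])

/-- Uniqueness of real power series. -/
lemma eq_of_hasSum {a b : ℕ → ℍ[ℝ]} {f : ℝ → ℍ[ℝ]}
    (ha : ∀ x : ℝ, |x| < 1 → HasSum (fun n : ℕ => (x : ℍ[ℝ]) ^ n * a n) (f x))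
    (hb : ∀ x : ℝ, |x| < 1 → HasSum (fun n : ℕ => (x : ℍ[ℝ]) ^ n * b n) (f x)) : a = b := by
  have key : ∀ c : ℕ → ℍ[ℝ],
      (∀ x : ℝ, |x| < 1 → HasSum (fun n : ℕ => (x : ℍ[ℝ]) ^ n * c n) (f x)) →
      HasFPowerSeriesAt f
        (fun n => ContinuousMultilinearMap.mkPiRing ℝ (Fin n) (c n) :
          FormalMultilinearSeries ℝ ℝ ℍ[ℝ]) 0 := by
    intro c hc
    refine hasFPowerSeriesAt_iff.mpr ?_
    filter_upwards [Metric.ball_mem_nhds (0 : ℝ) one_pos] with x hx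
    have := hc x (by simpa using hx)
    simpa [FormalMultilinearSeries.coeff, ← Quaternion.coe_pow, Quaternion.coe_mul_eq_smul]
      using this
  have h := (key a ha).eq_formalMultilinearSeries (key b hb)
  funext n
  have h2 := congrArg (fun p => FormalMultilinearSeries.coeff p n) h
  simpa [FormalMultilinearSeries.coeff] using h2

lemma ev_injective {φ ψ : PowerSeries ℍ[ℝ]} (h : Conv φ) (h' : Conv ψ)
    (e : ∀ q, ‖q‖ < 1 → ev φ q = ev ψ q) : φ = ψ := by
  ext1 n
  refine congrFun (eq_of_hasSum (a := fun n => PowerSeries.coeff n φ)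
    (b := fun n => PowerSeries.coeff n ψ) (f := fun x => ev φ (x : ℍ[ℝ])) (fun x hx => ?_)
    fun x hx => ?_) n
  · exact h.hasSum (by simpa using hx)
  · rw [e _ (by simpa using hx)]
    exact h'.hasSum (by simpa using hx)

/-- These are the Taylor expansion and Cauchy estimates of a vector-valued holomorphic function; the
estimates on radius R < 1 lose R⁻ⁿ, removed by R → 1. -/
lemma exists_slice_hasSum (ι : ℂ →ₐ[ℝ] ℍ[ℝ]) (f : ℂ → ℍ[ℝ])
    (hf : letI := sliceSpace ι; DifferentiableOn ℂ f (Metric.ball (0 : ℂ) 1)) :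
    ∃ b : ℕ → ℍ[ℝ], (∀ z : ℂ, ‖z‖ < 1 → HasSum (fun n : ℕ => ι z ^ n * b n) (f z)) ∧
      ∀ M : ℝ, (∀ z : ℂ, ‖z‖ < 1 → ‖f z‖ ≤ M) → ∀ n, ‖b n‖ ≤ M := by
  let := sliceSpace ι
  refine ⟨fun n => (n.factorial : ℂ)⁻¹ • iteratedDeriv n f 0, fun z hz => ?_, fun M hM n => ?_⟩
  · have := Complex.hasSum_taylorSeries_on_ball hf (mem_ball_zero_iff.mpr hz)
    simp only [sub_zero, sliceSpace_smul] at this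
    refine this.congr_fun fun n => ?_
    change ι z ^ n * (ι _ * _) = _
    rw [← mul_assoc, ← mul_assoc, ← map_pow, ← map_mul, ← map_mul, mul_comm]
  · have hM0 : 0 ≤ M := (norm_nonneg _).trans (hM 0 (by simp))
    have key : ∀ R : ℝ, 0 < R → R < 1 → ‖(n.factorial : ℂ)⁻¹ • iteratedDeriv n f 0‖ * R ^ n ≤ M := by
      intro R hR hR1
      have hd : DiffContOnCl ℂ f (Metric.ball (0 : ℂ) R) := by
        refine (DifferentiableOn.mono hf ?_).diffContOnCl
        rw [closure_ball _ hR.ne']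
        exact Metric.closedBall_subset_ball hR1
      have := Complex.norm_iteratedDeriv_le_of_forall_mem_sphere_norm_le n hR hd
        (fun z hz => hM z (by rw [mem_sphere_zero_iff_norm.mp hz]; exact hR1))
      rw [le_div_iff₀ (by positivity)] at this
      have hfac : (0 : ℝ) < n.factorial := by positivity
      rw [norm_smul, norm_inv, Complex.norm_natCast, mul_assoc, inv_mul_le_iff₀ hfac]
      exact this
    have ht : Filter.Tendsto
        (fun R : ℝ => ‖(n.factorial : ℂ)⁻¹ • iteratedDeriv n f 0‖ * R ^ n)
        (nhdsWithin 1 (Set.Iio 1)) (nhds (‖(n.factorial : ℂ)⁻¹ • iteratedDeriv n f 0‖ * 1 ^ n)) :=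
      Filter.Tendsto.mono_left (Continuous.tendsto (by fun_prop) 1) nhdsWithin_le_nhds
    rw [one_pow, mul_one] at ht
    refine le_of_tendsto ht ?_
    filter_upwards [Ioo_mem_nhdsLT (zero_lt_one' ℝ)] with R hR using key R hR.1 hR.2

/-- Cauchy estimate for the coefficients. -/
lemma norm_coeff_le {φ : PowerSeries ℍ[ℝ]} (h : Conv φ) {M : ℝ}
    (hM : ∀ q, ‖q‖ < 1 → ‖ev φ q‖ ≤ M) (n : ℕ) : ‖PowerSeries.coeff n φ‖ ≤ M := by
  obtain ⟨I, hI, -⟩ := exists_slice 0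
  obtain ⟨b, hb, hbM⟩ := exists_slice_hasSum (sliceEmb hI) _ (differentiableOn_ev (sliceEmb hI) h)
  have hx : ∀ x : ℝ, sliceEmb hI (x : ℂ) = (x : ℍ[ℝ]) := fun x => (sliceEmb hI).commutes x
  -- The real axis lies in the slice and already determines the coefficients.
  have e : (fun n => PowerSeries.coeff n φ) = b := by
    refine eq_of_hasSum (f := fun x => ev φ (x : ℍ[ℝ])) (fun x hx1 => ?_) fun x hx1 => ?_
    · exact h.hasSum (by simpa using hx1)
    · simpa only [hx] using hb (x : ℂ) (by simpa using hx1)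
  have := hbM M (fun z hz => hM _ (by rw [norm_algHom]; exact hz)) n
  rwa [← e] at this

/-! ### Slice regular functions as power series -/

/-- `f` is represented on the unit ball by the power series `φ`. -/
def Rep (f : ℍ[ℝ] → ℍ[ℝ]) (φ : PowerSeries ℍ[ℝ]) : Prop :=
  Conv φ ∧ ∀ q, ‖q‖ < 1 → f q = ev φ q

/-- The equation in the definition says that the real differential commutes with left multiplication
by I, that is, it is complex linear for the slice structure. -/
lemma SliceRegular.differentiableOn {f : ℍ[ℝ] → ℍ[ℝ]} (hf : SliceRegular f) {I : ℍ[ℝ]}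
    (hI : I ^ 2 = -1) :
    letI := sliceSpace (sliceEmb hI)
    DifferentiableOn ℂ (fun z => f (sliceEmb hI z)) (Metric.ball (0 : ℂ) 1) := by
  let := sliceSpace (sliceEmb hI)
  have := sliceSpace_tower (sliceEmb hI)
  intro z hz
  rw [mem_ball_zero_iff] at hz
  obtain ⟨h1, h2⟩ := hf I hI z.re z.im (by
    rw [mem_unitBall, ← sliceEmb_apply hI z, norm_algHom]; exact hz)
  set g : ℝ × ℝ → ℍ[ℝ] := fun p => f ((p.1 : ℍ[ℝ]) + I * (p.2 : ℍ[ℝ])) with hg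
  have hgd := h1.hasFDerivAt
  set g' := fderiv ℝ g (z.re, z.im)
  have hx : deriv (fun s : ℝ => f ((s : ℍ[ℝ]) + I * (z.im : ℍ[ℝ]))) z.re = g' (1, 0) := by
    have h3 : HasDerivAt (fun s : ℝ => (s, z.im)) ((1 : ℝ), (0 : ℝ)) z.re :=
      (hasDerivAt_id _).prodMk (hasDerivAt_const _ _)
    exact (HasFDerivAt.comp_hasDerivAt z.re (f := fun s : ℝ => (s, z.im)) hgd h3).deriv
  have hy : deriv (fun t : ℝ => f ((z.re : ℍ[ℝ]) + I * (t : ℍ[ℝ]))) z.im = g' (0, 1) := by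
    have h3 : HasDerivAt (fun t : ℝ => (z.re, t)) ((0 : ℝ), (1 : ℝ)) z.im :=
      (hasDerivAt_const _ _).prodMk (hasDerivAt_id _)
    exact (HasFDerivAt.comp_hasDerivAt z.im (f := fun t : ℝ => (z.re, t)) hgd h3).deriv
  rw [hx, hy] at h2
  have h4 : g' (0, 1) = I * g' (1, 0) := by
    have h5 : g' (1, 0) + I * g' (0, 1) = 0 := by
      exact (smul_eq_zero.mp h2).resolve_left (by norm_num)
    have h6 : g' (1, 0) = -(I * g' (0, 1)) := eq_neg_of_add_eq_zero_left h5
    rw [h6, mul_neg, ← mul_assoc, ← sq, hI]; simp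
  have hG : HasFDerivAt (fun w : ℂ => f (sliceEmb hI w))
      (g'.comp (Complex.equivRealProdCLM : ℂ →L[ℝ] ℝ × ℝ)) z := by
    have h7 : (fun w : ℂ => f (sliceEmb hI w)) = g ∘ Complex.equivRealProdCLM := by
      funext w
      simp [hg, sliceEmb_apply]
    rw [h7]
    exact HasFDerivAt.comp z (g := g) hgd Complex.equivRealProdCLM.hasFDerivAt
  have hC : HasFDerivAt (𝕜 := ℂ) (fun w : ℂ => f (sliceEmb hI w))
      (ContinuousLinearMap.toSpanSingleton ℂ (g' (1, 0))) z := by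
    refine hasFDerivAt_of_restrictScalars ℝ hG ?_
    refine ContinuousLinearMap.ext fun w => ?_
    have h8 : g' (w.re, w.im) = w.re • g' (1, 0) + w.im • g' (0, 1) := by
      rw [← map_smul, ← map_smul, ← map_add]; simp
    change sliceEmb hI w * g' (1, 0) = g' (w.re, w.im)
    rw [h8, h4, sliceEmb_apply, add_mul, Quaternion.coe_mul_eq_smul, ← Quaternion.coe_commutes,
      Quaternion.coe_mul_eq_smul, smul_mul_assoc]
  exact hC.differentiableAt.differentiableWithinAt

/-- Each slice has its own Taylor series; all slices share the real axis, so the coefficients do not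
depend on I. -/
lemma SliceRegular.exists_rep {f : ℍ[ℝ] → ℍ[ℝ]} (hf : SliceRegular f) : ∃ φ, Rep f φ := by
  have key : ∀ (I : ℍ[ℝ]) (hI : I ^ 2 = -1), ∃ b : ℕ → ℍ[ℝ],
      ∀ z : ℂ, ‖z‖ < 1 → HasSum (fun n : ℕ => sliceEmb hI z ^ n * b n) (f (sliceEmb hI z)) := by
    intro I hI
    obtain ⟨b, hb, -⟩ := exists_slice_hasSum (sliceEmb hI) _ (hf.differentiableOn hI)
    exact ⟨b, hb⟩
  obtain ⟨I₀, hI₀, -⟩ := exists_slice 0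
  obtain ⟨b, hb⟩ := key I₀ hI₀
  have hr : ∀ (I : ℍ[ℝ]) (hI : I ^ 2 = -1) (x : ℝ), sliceEmb hI (x : ℂ) = (x : ℍ[ℝ]) :=
    fun I hI x => (sliceEmb hI).commutes x
  have hsum : ∀ q : ℍ[ℝ], ‖q‖ < 1 → HasSum (fun n : ℕ => q ^ n * b n) (f q) := by
    intro q hq
    obtain ⟨I, hI, z, rfl⟩ := exists_slice q
    obtain ⟨c, hc⟩ := key I hI
    have e : b = c := by
      refine eq_of_hasSum (f := fun x => f (x : ℍ[ℝ])) (fun x hx => ?_) fun x hx => ?_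
      · simpa only [hr] using hb (x : ℂ) (by simpa using hx)
      · simpa only [hr] using hc (x : ℂ) (by simpa using hx)
    rw [e]
    exact hc z (by rwa [norm_algHom] at hq)
  refine ⟨PowerSeries.mk b, Conv.of_summable fun x h0 h1 => ?_, fun q hq => ?_⟩
  · simpa using (hsum x (by simpa [abs_of_pos h0] using h1)).summable
  · simpa [ev] using (hsum q hq).tsum_eq.symm

lemma Rep.sliceRegular {f : ℍ[ℝ] → ℍ[ℝ]} {φ : PowerSeries ℍ[ℝ]} (h : Rep f φ) :
    SliceRegular f := by
  intro I hI x y hxy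
  let := sliceSpace (sliceEmb hI)
  have := sliceSpace_tower (sliceEmb hI)
  set z : ℂ := ⟨x, y⟩ with hz
  have hz1 : ‖z‖ < 1 := by
    rw [← norm_algHom (sliceEmb hI), sliceEmb_apply]; exact mem_unitBall.mp hxy
  have hmem : Metric.ball (0 : ℂ) 1 ∈ nhds z :=
    Metric.isOpen_ball.mem_nhds (mem_ball_zero_iff.mpr hz1)
  have hd : HasDerivAt (fun w : ℂ => f (sliceEmb hI w))
      (deriv (fun w : ℂ => ev φ (sliceEmb hI w)) z) z := by
    have h1 := ((differentiableOn_ev (sliceEmb hI) h.1).differentiableAt hmem).hasDerivAt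
    refine h1.congr_of_eventuallyEq ?_
    filter_upwards [hmem] with w hw
    exact h.2 _ (by rw [norm_algHom]; exact mem_ball_zero_iff.mp hw)
  set D := deriv (fun w : ℂ => ev φ (sliceEmb hI w)) z
  have hF := hd.hasFDerivAt.restrictScalars ℝ
  have hg : HasFDerivAt (fun p : ℝ × ℝ => f ((p.1 : ℍ[ℝ]) + I * (p.2 : ℍ[ℝ])))
      (((ContinuousLinearMap.toSpanSingleton ℂ D).restrictScalars ℝ).comp
        (Complex.equivRealProdCLM.symm : ℝ × ℝ →L[ℝ] ℂ)) (x, y) := by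
    have h7 : (fun p : ℝ × ℝ => f ((p.1 : ℍ[ℝ]) + I * (p.2 : ℍ[ℝ]))) =
        (fun w : ℂ => f (sliceEmb hI w)) ∘ Complex.equivRealProdCLM.symm := by
      funext w
      simp [sliceEmb_apply]
    rw [h7]
    exact HasFDerivAt.comp (x, y) (g := fun w : ℂ => f (sliceEmb hI w)) hF
      Complex.equivRealProdCLM.symm.hasFDerivAt
  refine ⟨hg.differentiableAt, ?_⟩
  have hx : HasDerivAt (fun s : ℝ => f ((s : ℍ[ℝ]) + I * (y : ℍ[ℝ]))) D x := by
    have h3 : HasDerivAt (fun s : ℝ => (s, y)) ((1 : ℝ), (0 : ℝ)) x :=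
      (hasDerivAt_id _).prodMk (hasDerivAt_const _ _)
    have h4 := HasFDerivAt.comp_hasDerivAt x (f := fun s : ℝ => (s, y)) hg h3
    refine h4.congr_deriv ?_
    change sliceEmb hI ⟨1, 0⟩ * D = D
    simp [sliceEmb_apply]
  have hy : HasDerivAt (fun t : ℝ => f ((x : ℍ[ℝ]) + I * (t : ℍ[ℝ]))) (I * D) y := by
    have h3 : HasDerivAt (fun t : ℝ => (x, t)) ((0 : ℝ), (1 : ℝ)) y :=
      (hasDerivAt_const _ _).prodMk (hasDerivAt_id _)
    have h4 := HasFDerivAt.comp_hasDerivAt y (f := fun t : ℝ => (x, t)) hg h3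
    refine h4.congr_deriv ?_
    change sliceEmb hI ⟨0, 1⟩ * D = I * D
    simp [sliceEmb_apply]
  rw [hx.deriv, hy.deriv, ← mul_assoc, ← sq, hI]
  simp

lemma Rep.ev {φ : PowerSeries ℍ[ℝ]} (h : Conv φ) : Rep (ev φ) φ := ⟨h, fun _ _ => rfl⟩

lemma Rep.coeff_eq {f : ℍ[ℝ] → ℍ[ℝ]} {φ : PowerSeries ℍ[ℝ]} (h : Rep f φ) (n : ℕ) :
    coeff f n = PowerSeries.coeff n φ := by
  have hφ : HasPowerSeries f fun n => PowerSeries.coeff n φ := fun q hq => by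
    rw [h.2 q (mem_unitBall.mp hq)]; exact h.1.hasSum (mem_unitBall.mp hq)
  have hex : ∃ a, HasPowerSeries f a := ⟨_, hφ⟩
  rw [coeff, dif_pos hex]
  refine congrFun (eq_of_hasSum (f := fun x => f (x : ℍ[ℝ])) (b := fun n => PowerSeries.coeff n φ)
    (fun x hx => ?_) fun x hx => ?_) n
  · exact hex.choose_spec _ (mem_unitBall.mpr (by simpa using hx))
  · exact hφ _ (mem_unitBall.mpr (by simpa using hx))

lemma Rep.regMul_eq {f g : ℍ[ℝ] → ℍ[ℝ]} {φ ψ : PowerSeries ℍ[ℝ]} (h : Rep f φ) (h' : Rep g ψ)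
    (q : ℍ[ℝ]) : regMul f g q = SliceRegularBall.ev (φ * ψ) q := by
  refine tsum_congr fun n => ?_
  rw [PowerSeries.coeff_mul]
  simp only [h.coeff_eq, h'.coeff_eq]
  rw [← Finset.Nat.sum_antidiagonal_eq_sum_range_succ
    fun i j => PowerSeries.coeff i φ * PowerSeries.coeff j ψ]

lemma Rep.regMul {f g : ℍ[ℝ] → ℍ[ℝ]} {φ ψ : PowerSeries ℍ[ℝ]} (h : Rep f φ) (h' : Rep g ψ) :
    Rep (regMul f g) (φ * ψ) :=
  ⟨h.1.mul h'.1, fun q _ => h.regMul_eq h' q⟩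

lemma Rep.regConj {f : ℍ[ℝ] → ℍ[ℝ]} {φ : PowerSeries ℍ[ℝ]} (h : Rep f φ) :
    Rep (regConj f) (conj φ) :=
  ⟨h.1.conj, fun q _ => tsum_congr fun n => by rw [h.coeff_eq, coeff_conj]⟩

lemma Rep.symmetrization_eq {f : ℍ[ℝ] → ℍ[ℝ]} {φ : PowerSeries ℍ[ℝ]} (h : Rep f φ) (q : ℍ[ℝ]) :
    symmetrization f q = SliceRegularBall.ev (φ * conj φ) q :=
  h.regMul_eq h.regConj q

lemma Rep.sub {f g : ℍ[ℝ] → ℍ[ℝ]} {φ ψ : PowerSeries ℍ[ℝ]} (h : Rep f φ) (h' : Rep g ψ) :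
    Rep (fun q => f q - g q) (φ - ψ) :=
  ⟨h.1.sub h'.1, fun q hq => by
    rw [ev_sub h.1 h'.1 hq, ← h.2 q hq, ← h'.2 q hq]⟩

lemma Rep.const (a : ℍ[ℝ]) : Rep (fun _ => a) (PowerSeries.C a) :=
  ⟨conv_C a, fun q _ => (ev_C a q).symm⟩

lemma Rep.one : Rep (fun _ => 1) 1 := by simpa using Rep.const 1

lemma Rep.id : Rep (fun q => q) PowerSeries.X := ⟨conv_X, fun q _ => (ev_X q).symm⟩

lemma ev_mul_C {φ : PowerSeries ℍ[ℝ]} (h : Conv φ) (a : ℍ[ℝ]) {q : ℍ[ℝ]} (hq : ‖q‖ < 1) :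
    ev (φ * PowerSeries.C a) q = ev φ q * a := by
  refine HasSum.tsum_eq ?_
  simpa [← mul_assoc] using (h.hasSum hq).mul_right a

lemma Rep.mul_const {f : ℍ[ℝ] → ℍ[ℝ]} {φ : PowerSeries ℍ[ℝ]} (h : Rep f φ) (a : ℍ[ℝ]) :
    Rep (fun q => f q * a) (φ * PowerSeries.C a) :=
  ⟨h.1.mul (conv_C a), fun q hq => by
    rw [ev_mul_C h.1 a hq, ← h.2 q hq]⟩

/-! ### Regular reciprocals and quotients -/

/-- A two-sided regular reciprocal makes the symmetrization invertible. -/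
lemma symm_mul_symm_of_inverse {a b : PowerSeries ℍ[ℝ]} (hab : a * b = 1) (hba : b * a = 1) :
    a * conj a * (b * conj b) = 1 := by
  rw [← conj_mul_self a, mul_assoc, ← mul_assoc a b, hab, one_mul, ← conj_mul, hba, conj_one]

lemma ev_symm_ne_zero {a b : PowerSeries ℍ[ℝ]} (ha : Conv a) (hb : Conv b) (hab : a * b = 1)
    (hba : b * a = 1) {q : ℍ[ℝ]} (hq : ‖q‖ < 1) : ev (a * conj a) q ≠ 0 := by
  intro h0
  have := ev_mul_of_eq_zero (ha.mul ha.conj) (hb.mul hb.conj) hq h0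
  rw [symm_mul_symm_of_inverse hab hba, ev_one] at this
  exact one_ne_zero this

/-- An inverse series makes η^s zero-free on the ball, and η^s * (γ * κ) = γ * η^c because η^s is
central. So the pointwise quotient is an honest product of series. -/
lemma Rep.rightQuot_eq {g h : ℍ[ℝ] → ℍ[ℝ]} {γ η κ : PowerSeries ℍ[ℝ]} (hg : Rep g γ)
    (hh : Rep h η) (hκ : Conv κ) (h1 : η * κ = 1) (h2 : κ * η = 1) {q : ℍ[ℝ]} (hq : ‖q‖ < 1) :
    rightQuot g h q = SliceRegularBall.ev (γ * κ) q := by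
  have h0 := ev_symm_ne_zero hh.1 hκ h1 h2 hq
  have e : η * conj η * (γ * κ) = γ * conj η := by
    rw [← mul_assoc, ((isReal_mul_conj η).commute γ).eq, ← conj_mul_self, mul_assoc, mul_assoc, h1,
      mul_one]
  rw [rightQuot, hh.symmetrization_eq, hg.regMul_eq hh.regConj, inv_mul_eq_iff_eq_mul₀ h0,
    ← (isReal_mul_conj η).ev_mul (hh.1.mul hh.1.conj) (hg.1.mul hκ) hq, e]

lemma Rep.regRecip_eq {h : ℍ[ℝ] → ℍ[ℝ]} {η κ : PowerSeries ℍ[ℝ]}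
    (hh : Rep h η) (hκ : Conv κ) (h1 : η * κ = 1) (h2 : κ * η = 1) {q : ℍ[ℝ]} (hq : ‖q‖ < 1) :
    regRecip h q = SliceRegularBall.ev κ q := by
  have h0 := ev_symm_ne_zero hh.1 hκ h1 h2 hq
  have e : η * conj η * κ = conj η * 1 := by
    rw [← conj_mul_self, mul_assoc, h1]
  rw [regRecip, leftQuot, hh.symmetrization_eq, hh.regConj.regMul_eq Rep.one,
    inv_mul_eq_iff_eq_mul₀ h0,
    ← (isReal_mul_conj η).ev_mul (hh.1.mul hh.1.conj) hκ hq, e]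

/-- Geometric series for the regular product. -/
lemma exists_inverse_one_sub {ψ : PowerSeries ℍ[ℝ]} (h : Conv ψ) {ρ : ℝ} (hρ : ρ < 1)
    (hψ : ∀ q, ‖q‖ < 1 → ‖ev ψ q‖ ≤ ρ) :
    ∃ κ, Conv κ ∧ (1 - ψ) * κ = 1 ∧ κ * (1 - ψ) = 1 := by
  have hρ0 : 0 ≤ ρ := (norm_nonneg _).trans (hψ 0 (by simp))
  have hev : ∀ (m : ℕ) (q : ℍ[ℝ]), ‖q‖ < 1 → ‖ev (ψ ^ m) q‖ ≤ ρ ^ m := by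
    intro m
    induction m with
    | zero => intro q _; simp
    | succ m ih =>
      intro q hq
      rw [pow_succ', pow_succ']
      exact (norm_ev_mul_le h (h.pow m) hq fun u hu => ih u (hu ▸ hq)).trans
        (mul_le_mul_of_nonneg_right (hψ q hq) (by positivity))
  -- Cauchy's estimate turns the bound on values into one uniform in n, so the geometric series can
  -- be summed coefficient by coefficient.
  have hc : ∀ m n : ℕ, ‖PowerSeries.coeff n (ψ ^ m)‖ ≤ ρ ^ m :=
    fun m n => norm_coeff_le (h.pow m) (hev m) n
  have hgeo := hasSum_geometric_of_lt_one hρ0 hρ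
  have hs : ∀ n, Summable fun m : ℕ => PowerSeries.coeff n (ψ ^ m) :=
    fun n => Summable.of_norm_bounded hgeo.summable fun m => hc m n
  obtain ⟨κ, hκ⟩ : ∃ κ : PowerSeries ℍ[ℝ],
      ∀ n, PowerSeries.coeff n κ = ∑' m : ℕ, PowerSeries.coeff n (ψ ^ m) :=
    ⟨PowerSeries.mk _, fun n => PowerSeries.coeff_mk n _⟩
  have hstep : ∀ n, PowerSeries.coeff n κ =
      PowerSeries.coeff n 1 + ∑' m : ℕ, PowerSeries.coeff n (ψ ^ (m + 1)) := by
    intro n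
    rw [hκ, (hs n).tsum_eq_zero_add, pow_zero]
  have h1 : κ = 1 + ψ * κ := by
    ext1 n
    have hsum : HasSum (fun m : ℕ => PowerSeries.coeff n (ψ ^ (m + 1)))
        (PowerSeries.coeff n (ψ * κ)) := by
      simp only [pow_succ', PowerSeries.coeff_mul, hκ]
      exact hasSum_sum fun p _ => (hs p.2).hasSum.mul_left (PowerSeries.coeff p.1 ψ)
    rw [hstep, map_add, hsum.tsum_eq]
  have h2 : κ = 1 + κ * ψ := by
    ext1 n
    have hsum : HasSum (fun m : ℕ => PowerSeries.coeff n (ψ ^ (m + 1)))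
        (PowerSeries.coeff n (κ * ψ)) := by
      simp only [pow_succ, PowerSeries.coeff_mul, hκ]
      exact hasSum_sum fun p _ => (hs p.1).hasSum.mul_right (PowerSeries.coeff p.2 ψ)
    rw [hstep, map_add, hsum.tsum_eq]
  refine ⟨κ, Conv.of_bounded fun r h0 h1 => ⟨(1 - ρ)⁻¹, fun n => ?_⟩, ?_, ?_⟩
  · have hn : ‖PowerSeries.coeff n κ‖ ≤ (1 - ρ)⁻¹ := by
      rw [hκ]
      exact tsum_of_norm_bounded hgeo fun m => hc m n
    exact (mul_le_of_le_one_right (norm_nonneg _) (pow_le_one₀ h0.le h1.le)).trans hn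
  · rw [sub_mul, one_mul]; exact sub_eq_of_eq_add h1
  · rw [mul_sub, mul_one]; exact sub_eq_of_eq_add h2

/-! ### Division by linear factors and the spherical expansion -/

/-- Division with remainder by `q - q₀`. -/
lemma exists_eq_add_mul {φ : PowerSeries ℍ[ℝ]} (h : Conv φ) {q₀ : ℍ[ℝ]} (hq₀ : ‖q₀‖ < 1) :
    ∃ γ, Conv γ ∧ φ - PowerSeries.C (ev φ q₀) = (PowerSeries.X - PowerSeries.C q₀) * γ := by
  obtain ⟨a, ha⟩ : ∃ a : ℕ → ℍ[ℝ], ∀ n, PowerSeries.coeff n φ = a n := ⟨_, fun _ => rfl⟩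
  have hs : ∀ k, Summable fun m : ℕ => q₀ ^ m * a (m + k) := by
    intro k
    -- Summability of the shifted series comes from dividing by q₀ᵏ, impossible at 0.
    by_cases h0 : q₀ = 0
    · refine summable_of_ne_finset_zero (s := {0}) fun n hn => ?_
      simp only [Finset.mem_singleton] at hn
      simp [h0, hn]
    · have := (summable_nat_add_iff k).mpr (h.hasSum hq₀).summable
      simp only [ha] at this
      refine (this.mul_left ((q₀ ^ k)⁻¹)).congr fun m => ?_
      rw [← mul_assoc, add_comm m k, pow_add, inv_mul_cancel_left₀ (pow_ne_zero _ h0), add_comm]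
  -- These coefficients come from expanding (qᵏ - q₀ᵏ) aₖ = (q - q₀) * ∑ qⁿ q₀ᵐ aₖ over m + n + 1 =
  -- k.
  obtain ⟨γ, hγ⟩ : ∃ γ : PowerSeries ℍ[ℝ],
      ∀ n, PowerSeries.coeff n γ = ∑' m : ℕ, q₀ ^ m * a (m + (n + 1)) :=
    ⟨PowerSeries.mk _, fun n => PowerSeries.coeff_mk n _⟩
  have hrec : ∀ k, ∑' m : ℕ, q₀ ^ m * a (m + k) = a k + q₀ * ∑' m : ℕ, q₀ ^ m * a (m + (k + 1)) := by
    intro k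
    rw [(hs k).tsum_eq_zero_add, ← tsum_mul_left]
    congr 1
    · simp
    · refine tsum_congr fun m => ?_
      rw [pow_succ', mul_assoc, add_assoc, add_comm 1 k]
  refine ⟨γ, Conv.of_bounded fun r h0 h1 => ?_, ?_⟩
  · obtain ⟨s, hs1, hs2⟩ := exists_between (max_lt h1 hq₀)
    have hs0 : 0 < s := h0.trans ((le_max_left _ _).trans_lt hs1)
    have hsum := h s hs0.le hs2
    simp only [ha] at hsum
    refine ⟨(∑' n, ‖a n‖ * s ^ n) * s⁻¹, fun n => ?_⟩
    have hsh : Summable fun m : ℕ => ‖a (m + (n + 1))‖ * s ^ (m + (n + 1)) :=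
      (summable_nat_add_iff (f := fun m => ‖a m‖ * s ^ m) (n + 1)).mpr hsum
    have h3 : ‖PowerSeries.coeff n γ‖ ≤
        ∑' m : ℕ, ‖a (m + (n + 1))‖ * s ^ (m + (n + 1)) * (s ^ (n + 1))⁻¹ := by
      have hle : ∀ m : ℕ, ‖q₀ ^ m * a (m + (n + 1))‖ ≤
          ‖a (m + (n + 1))‖ * s ^ (m + (n + 1)) * (s ^ (n + 1))⁻¹ := by
        intro m
        rw [norm_mul, norm_pow, pow_add s m (n + 1), ← mul_assoc,
          mul_inv_cancel_right₀ (pow_ne_zero _ hs0.ne'), mul_comm]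
        gcongr
        exact (le_max_right _ _).trans hs1.le
      rw [hγ]
      exact tsum_of_norm_bounded (hsh.mul_right (s ^ (n + 1))⁻¹).hasSum hle
    have h4 : ∑' m : ℕ, ‖a (m + (n + 1))‖ * s ^ (m + (n + 1)) ≤ ∑' n, ‖a n‖ * s ^ n := by
      rw [← Summable.sum_add_tsum_nat_add (f := fun m => ‖a m‖ * s ^ m) (n + 1) hsum]
      exact le_add_of_nonneg_left (Finset.sum_nonneg fun _ _ => by positivity)
    rw [tsum_mul_right] at h3
    have h5 : r ^ n ≤ s ^ n := by
      gcongr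
      exact (le_max_left _ _).trans hs1.le
    calc ‖PowerSeries.coeff n γ‖ * r ^ n
        ≤ ((∑' n, ‖a n‖ * s ^ n) * (s ^ (n + 1))⁻¹) * s ^ n := by
          gcongr
          exact h3.trans (mul_le_mul_of_nonneg_right h4 (by positivity))
      _ = _ := by
          rw [pow_succ]; field_simp
  · ext1 n
    rw [sub_mul, map_sub, map_sub, PowerSeries.coeff_C_mul]
    cases n with
    | zero =>
      have h0 := hrec 0
      simp only [add_zero, zero_add] at h0
      rw [PowerSeries.coeff_C, if_pos rfl, PowerSeries.coeff_zero_X_mul, hγ,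
        show ev φ q₀ = ∑' m : ℕ, q₀ ^ m * a m by simp only [ev, ha], h0, ha]
      simp
    | succ n =>
      rw [PowerSeries.coeff_C, if_neg n.succ_ne_zero, PowerSeries.coeff_succ_X_mul, hγ,
        hγ, hrec (n + 1), ha]
      simp

/-- The series of `q - q₀`. -/
def linFactor (q₀ : ℍ[ℝ]) : PowerSeries ℍ[ℝ] := PowerSeries.X - PowerSeries.C q₀

/-- The series of `1 - q \bar q₀`. -/
def reflFactor (q₀ : ℍ[ℝ]) : PowerSeries ℍ[ℝ] := 1 - PowerSeries.X * PowerSeries.C (star q₀)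

lemma rep_linFactor (q₀ : ℍ[ℝ]) : Rep (fun q => q - q₀) (linFactor q₀) :=
  Rep.id.sub (Rep.const q₀)

lemma rep_reflFactor (q₀ : ℍ[ℝ]) : Rep (fun q => 1 - q * star q₀) (reflFactor q₀) :=
  Rep.one.sub (Rep.id.mul_const _)

@[simp] lemma conj_linFactor (q₀ : ℍ[ℝ]) : conj (linFactor q₀) = linFactor (star q₀) := by
  simp [linFactor, conj_sub]

@[simp] lemma conj_reflFactor (q₀ : ℍ[ℝ]) : conj (reflFactor q₀) = reflFactor (star q₀) := by
  simp [reflFactor, conj_sub, conj_mul, PowerSeries.X_mul]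

lemma linFactor_ne_zero (q₀ : ℍ[ℝ]) : linFactor q₀ ≠ 0 := by
  intro h
  have := congrArg (PowerSeries.coeff 1) h
  simp [linFactor] at this

lemma exists_inverse_reflFactor {q₀ : ℍ[ℝ]} (hq₀ : ‖q₀‖ < 1) :
    ∃ κ, Conv κ ∧ reflFactor q₀ * κ = 1 ∧ κ * reflFactor q₀ = 1 := by
  refine exists_inverse_one_sub (conv_X.mul (conv_C _)) hq₀ fun q hq => ?_
  rw [ev_mul_C conv_X _ hq, ev_X, norm_mul, Quaternion.norm_star]
  exact mul_le_of_le_one_left (norm_nonneg _) hq.le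

lemma commute_linFactor_reflFactor {p q : ℍ[ℝ]} (h : Commute p (star q)) :
    Commute (linFactor p) (reflFactor q) := by
  have hX : ∀ φ : PowerSeries ℍ[ℝ], Commute PowerSeries.X φ := fun φ =>
    (PowerSeries.commute_X φ).symm
  have hC : Commute (PowerSeries.C p) (PowerSeries.C (star q)) := h.map PowerSeries.C
  exact (hX _).sub_left
    ((Commute.one_right _).sub_right ((hX _).symm.mul_right hC))

/-- The differential quotient realizes division by `q - q₀`. -/
lemma Rep.diffQuot {f : ℍ[ℝ] → ℍ[ℝ]} {φ : PowerSeries ℍ[ℝ]} (h : Rep f φ) {q₀ : ℍ[ℝ]}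
    (hq₀ : ‖q₀‖ < 1) :
    ∃ γ, Rep (diffQuot q₀ f) γ ∧ φ = PowerSeries.C (f q₀) + linFactor q₀ * γ := by
  obtain ⟨γ, hγ, e⟩ := exists_eq_add_mul h.1 hq₀
  rw [← h.2 q₀ hq₀] at e
  have hp := rep_linFactor q₀
  have hsymm : Conv (linFactor q₀ * conj (linFactor q₀)) := hp.1.mul hp.1.conj
  have hreal := isReal_mul_conj (linFactor q₀)
  have key : ∀ q, ‖q‖ < 1 → symmetrization (fun p => p - q₀) q ≠ 0 →
      leftQuot (fun p => p - q₀) (fun p => f p - f q₀) q = SliceRegularBall.ev γ q := by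
    intro q hq h0
    rw [leftQuot, inv_mul_eq_iff_eq_mul₀ h0, hp.symmetrization_eq,
      hp.regConj.regMul_eq (h.sub (Rep.const (f q₀))), ← hreal.ev_mul hsymm hγ hq, e,
      ← conj_mul_self, mul_assoc]
    rfl
  have hex : ∃ g, IsDiffQuot q₀ f g :=
    ⟨SliceRegularBall.ev γ, (Rep.ev hγ).sliceRegular,
      fun q hq h0 => (key q (mem_unitBall.mp hq) h0).symm⟩
  refine ⟨γ, ?_, by rw [linFactor, ← e]; abel⟩
  rw [SliceRegularBall.diffQuot, dif_pos hex]
  obtain ⟨hreg, hval⟩ := hex.choose_spec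
  obtain ⟨γ', hγ'⟩ := hreg.exists_rep
  -- The chosen quotient is prescribed only off the zeros of (q - q₀)^s. Multiplying by this
  -- symmetrization gives equality everywhere, and it cancels because ℍ[[X]] has no zero divisors.
  have e2 : linFactor q₀ * conj (linFactor q₀) * γ' = linFactor q₀ * conj (linFactor q₀) * γ := by
    refine ev_injective (hsymm.mul hγ'.1) (hsymm.mul hγ) fun q hq => ?_
    rw [hreal.ev_mul hsymm hγ'.1 hq, hreal.ev_mul hsymm hγ hq]
    by_cases h0 : symmetrization (fun p => p - q₀) q = 0
    · rw [← hp.symmetrization_eq, h0, zero_mul, zero_mul]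
    · rw [← hγ'.2 q hq, hval q (mem_unitBall.mpr hq) h0, key q hq h0]
  have e3 := mul_left_cancel₀
    (mul_ne_zero (linFactor_ne_zero q₀) (by rw [conj_linFactor]; exact linFactor_ne_zero _)) e2
  rwa [e3] at hγ'

/-- One step of the spherical expansion. -/
lemma Rep.diffQuot_diffQuot {f : ℍ[ℝ] → ℍ[ℝ]} {φ : PowerSeries ℍ[ℝ]} (h : Rep f φ) {q₀ : ℍ[ℝ]}
    (hq₀ : ‖q₀‖ < 1) (h0 : SliceRegularBall.diffQuot q₀ f (star q₀) = 0) :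
    ∃ γ, Rep (SliceRegularBall.diffQuot (star q₀) (SliceRegularBall.diffQuot q₀ f)) γ ∧
      φ = PowerSeries.C (f q₀) + linFactor q₀ * conj (linFactor q₀) * γ := by
  obtain ⟨γ, hγ, e⟩ := h.diffQuot hq₀
  obtain ⟨δ, hδ, e'⟩ := hγ.diffQuot (q₀ := star q₀) (by rwa [Quaternion.norm_star])
  rw [h0, map_zero, zero_add] at e'
  exact ⟨δ, hδ, by rw [mul_assoc, conj_linFactor, ← e', ← e]⟩

lemma sphericalCoeff_two_mul (f : ℍ[ℝ] → ℍ[ℝ]) (q₀ : ℍ[ℝ]) (n : ℕ) :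
    sphericalCoeff f q₀ (2 * n) = iterDiffQuot q₀ n f q₀ := by
  simp [sphericalCoeff]

lemma sphericalCoeff_two_mul_add_one (f : ℍ[ℝ] → ℍ[ℝ]) (q₀ : ℍ[ℝ]) (n : ℕ) :
    sphericalCoeff f q₀ (2 * n + 1) = diffQuot q₀ (iterDiffQuot q₀ n f) (star q₀) := by
  rw [sphericalCoeff, if_neg (by simp), show (2 * n + 1) / 2 = n by omega]

lemma iterDiffQuot_succ (f : ℍ[ℝ] → ℍ[ℝ]) (q₀ : ℍ[ℝ]) (n : ℕ) :
    iterDiffQuot q₀ (n + 1) f = diffQuot (star q₀) (diffQuot q₀ (iterDiffQuot q₀ n f)) := by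
  rw [iterDiffQuot, Function.iterate_succ_apply']; rfl

/-- The spherical expansion when the coefficients of index `1, …, 2n - 1` vanish. -/
lemma Rep.iterDiffQuot {f : ℍ[ℝ] → ℍ[ℝ]} {φ : PowerSeries ℍ[ℝ]} (h : Rep f φ) {q₀ : ℍ[ℝ]}
    (hq₀ : ‖q₀‖ < 1) (n : ℕ) (hA : ∀ m, 1 ≤ m → m ≤ 2 * n + 1 → sphericalCoeff f q₀ m = 0) :
    ∃ γ, Rep (iterDiffQuot q₀ (n + 1) f) γ ∧
      φ = PowerSeries.C (f q₀) + (linFactor q₀ * conj (linFactor q₀)) ^ (n + 1) * γ := by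
  induction n with
  | zero =>
    have h1 := hA 1 le_rfl (by omega)
    rw [show 1 = 2 * 0 + 1 from rfl, sphericalCoeff_two_mul_add_one] at h1
    simpa [iterDiffQuot_succ, SliceRegularBall.iterDiffQuot] using h.diffQuot_diffQuot hq₀ h1
  | succ n ih =>
    obtain ⟨γ, hγ, e⟩ := ih fun m h1 h2 => hA m h1 (by omega)
    -- Extracting another quadratic factor from γ uses two coefficients: the even one is γ(q₀), the
    -- odd one is the value at q̄₀ of the next quotient.
    have h1 := hA (2 * (n + 1)) (by omega) (by omega)
    have h2 := hA (2 * (n + 1) + 1) (by omega) (by omega)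
    rw [sphericalCoeff_two_mul] at h1
    rw [sphericalCoeff_two_mul_add_one] at h2
    obtain ⟨δ, hδ, e'⟩ := hγ.diffQuot_diffQuot hq₀ h2
    rw [h1, map_zero, zero_add] at e'
    refine ⟨δ, by rwa [iterDiffQuot_succ], ?_⟩
    rw [pow_succ _ (n + 1), mul_assoc, ← e', ← e]

/-! ### The Schwarz lemma -/

lemma norm_one_sub_mul_star_le {q₀ u : ℍ[ℝ]} (hq₀ : ‖q₀‖ < ‖u‖) (hu : ‖u‖ < 1) :
    ‖1 - u * star q₀‖ ≤ (1 + (1 - ‖u‖ ^ 2) / (‖u‖ - ‖q₀‖)) * ‖u - q₀‖ := by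
  -- The first term tends to 0 at the boundary and the second has norm at most |u - q₀|; dividing by
  -- |u| - |q₀| makes the error relative.
  have e : 1 - u * star q₀ = ((1 - ‖u‖ ^ 2 : ℝ) : ℍ[ℝ]) + u * star (u - q₀) := by
    rw [star_sub, mul_sub, Quaternion.self_mul_star, Quaternion.normSq_eq_norm_mul_self]
    push_cast
    rw [sq]; abel
  have h1 : 0 ≤ 1 - ‖u‖ ^ 2 := by nlinarith [norm_nonneg u]
  have h2 : 0 < ‖u‖ - ‖q₀‖ := sub_pos.mpr hq₀
  have h3 : ‖u‖ - ‖q₀‖ ≤ ‖u - q₀‖ := norm_sub_norm_le u q₀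
  calc ‖1 - u * star q₀‖ ≤ (1 - ‖u‖ ^ 2) + ‖u‖ * ‖u - q₀‖ := by
        rw [e]
        refine (norm_add_le _ _).trans (le_of_eq ?_)
        rw [norm_mul, Quaternion.norm_star, Quaternion.norm_coe, Real.norm_of_nonneg h1]
    _ ≤ (1 - ‖u‖ ^ 2) / (‖u‖ - ‖q₀‖) * ‖u - q₀‖ + 1 * ‖u - q₀‖ := by
        gcongr
        rw [div_mul_eq_mul_div, le_div_iff₀ h2]
        exact mul_le_mul_of_nonneg_left h3 h1
    _ = _ := by ring

lemma ev_linFactor {q₀ q : ℍ[ℝ]} (hq : ‖q‖ < 1) : ev (linFactor q₀) q = q - q₀ :=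
  ((rep_linFactor q₀).2 q hq).symm

lemma ev_reflFactor {q₀ q : ℍ[ℝ]} (hq : ‖q‖ < 1) : ev (reflFactor q₀) q = 1 - q * star q₀ :=
  ((rep_reflFactor q₀).2 q hq).symm

/-- Zeros of (q - q₀)^s have norm |q₀|: the second factor q - q̄₀ is evaluated at a conjugate of q,
which has the norm of q. -/
lemma ev_linFactor_symm_ne_zero {q₀ q : ℍ[ℝ]} (hq₀ : ‖q₀‖ < ‖q‖) (hq : ‖q‖ < 1) :
    ev (linFactor q₀ * conj (linFactor q₀)) q ≠ 0 := by
  have h1 : ev (linFactor q₀) q ≠ 0 := by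
    rw [ev_linFactor hq, sub_ne_zero]; rintro rfl; exact lt_irrefl _ hq₀
  rw [ev_mul (rep_linFactor q₀).1 (rep_linFactor q₀).1.conj hq h1, conj_linFactor]
  have hn := norm_inv_mul_mul (q := q) h1
  refine mul_ne_zero h1 ?_
  rw [ev_linFactor (by rwa [hn]), sub_ne_zero]
  intro h
  rw [h, Quaternion.norm_star] at hn
  exact hq₀.ne hn

/-- Schwarz lemma: a factor `q - q₀` of a function bounded by one can be replaced by
`1 - q \bar q₀`. -/
lemma norm_ev_reflFactor_mul_le {q₀ : ℍ[ℝ]} (hq₀ : ‖q₀‖ < 1) {χ : PowerSeries ℍ[ℝ]} (hχ : Conv χ)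
    (h : ∀ q, ‖q‖ < 1 → ‖ev (linFactor q₀ * χ) q‖ ≤ 1) {q : ℍ[ℝ]} (hq : ‖q‖ < 1) :
    ‖ev (reflFactor q₀ * χ) q‖ ≤ 1 := by
  have hp := (rep_linFactor q₀).1
  have hr := (rep_reflFactor q₀).1
  have e : linFactor q₀ * (reflFactor q₀ * χ) = reflFactor q₀ * (linFactor q₀ * χ) := by
    rw [← mul_assoc, (commute_linFactor_reflFactor (star_comm_self' q₀).symm).eq, mul_assoc]
  -- On the sphere of radius ρ, beyond both q₀ and q, the loss is the factor on the right, which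
  -- tends to 1 as ρ → 1.
  have key : ∀ ρ : ℝ, ‖q₀‖ < ρ → ‖q‖ < ρ → ρ < 1 →
      ‖ev (reflFactor q₀ * χ) q‖ ≤ 1 + (1 - ρ ^ 2) / (ρ - ‖q₀‖) := by
    intro ρ h1 h2 h3
    refine norm_ev_le_of_sphere (hr.mul hχ) h3 (fun w hw => ?_) h2
    subst hw
    refine norm_ev_le_of_mul_eq hp (hr.mul hχ) (hr.mul (hp.mul hχ)) e h3
      (ev_linFactor_symm_ne_zero h1 h3) fun u hu => ?_
    have hu1 : ‖u‖ < 1 := hu ▸ h3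
    refine (norm_ev_mul_le hr (hp.mul hχ) hu1 fun v hv => h v (hv ▸ hu1)).trans ?_
    rw [mul_one, ev_reflFactor hu1, ev_linFactor hu1, ← hu]
    exact norm_one_sub_mul_star_le (hu ▸ h1) hu1
  have ht : Filter.Tendsto (fun ρ : ℝ => 1 + (1 - ρ ^ 2) / (ρ - ‖q₀‖))
      (nhdsWithin 1 (Set.Iio 1)) (nhds (1 + (1 - 1 ^ 2) / (1 - ‖q₀‖))) := by
    refine Filter.Tendsto.mono_left (ContinuousAt.tendsto ?_) nhdsWithin_le_nhds
    have : (1 : ℝ) - ‖q₀‖ ≠ 0 := by linarith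
    fun_prop (disch := exact this)
  rw [one_pow, sub_self, zero_div, add_zero] at ht
  refine ge_of_tendsto ht ?_
  filter_upwards [Ioo_mem_nhdsLT (max_lt hq₀ hq)] with ρ hρ
  exact key ρ ((le_max_left _ _).trans_lt hρ.1) ((le_max_right _ _).trans_lt hρ.1) hρ.2

/-- Each quadratic factor splits into linear factors at q₀ and q̄₀, replaced one after the other.
This works because 1 - q q̄₀ commutes with q - q̄₀, so the second linear factor can be brought to
the front. -/
lemma norm_ev_reflFactor_symm_pow_mul_le {q₀ : ℍ[ℝ]} (hq₀ : ‖q₀‖ < 1) (n : ℕ)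
    {χ : PowerSeries ℍ[ℝ]} (hχ : Conv χ)
    (h : ∀ q, ‖q‖ < 1 → ‖ev ((linFactor q₀ * conj (linFactor q₀)) ^ n * χ) q‖ ≤ 1)
    {q : ℍ[ℝ]} (hq : ‖q‖ < 1) :
    ‖ev ((reflFactor q₀ * conj (reflFactor q₀)) ^ n * χ) q‖ ≤ 1 := by
  have hp := (rep_linFactor q₀).1
  have hr := (rep_reflFactor q₀).1
  have hS := hp.mul hp.conj
  have hT := hr.mul hr.conj
  have hq₀' : ‖star q₀‖ < 1 := by rwa [Quaternion.norm_star]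
  induction n generalizing χ q with
  | zero => simpa using h q hq
  | succ n ih =>
    rw [pow_succ, mul_assoc]
    refine ih (hT.mul hχ) (fun u hu => ?_) hq
    set S := linFactor q₀ * conj (linFactor q₀) with hSdef
    set T := reflFactor q₀ * conj (reflFactor q₀) with hTdef
    have e1 : S ^ (n + 1) * χ = linFactor q₀ * (conj (linFactor q₀) * (S ^ n * χ)) := by
      rw [pow_succ', mul_assoc, hSdef, mul_assoc]
    have h1 : ∀ q, ‖q‖ < 1 →
        ‖ev (reflFactor q₀ * (conj (linFactor q₀) * (S ^ n * χ))) q‖ ≤ 1 := fun q hq =>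
      norm_ev_reflFactor_mul_le hq₀ (hp.conj.mul ((hS.pow n).mul hχ))
        (fun q hq => by rw [← e1]; exact h q hq) hq
    have e2 : reflFactor q₀ * (conj (linFactor q₀) * (S ^ n * χ)) =
        linFactor (star q₀) * (reflFactor q₀ * (S ^ n * χ)) := by
      rw [← mul_assoc, conj_linFactor,
        ← (commute_linFactor_reflFactor (Commute.refl (star q₀))).eq, mul_assoc]
    have h2 := norm_ev_reflFactor_mul_le hq₀' (hr.mul ((hS.pow n).mul hχ))
      (fun q hq => by rw [← e2]; exact h1 q hq) hu
    have e3 : reflFactor (star q₀) * (reflFactor q₀ * (S ^ n * χ)) = S ^ n * (T * χ) := by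
      rw [← conj_reflFactor, ← mul_assoc, conj_mul_self, ← hTdef, ← mul_assoc, ← mul_assoc,
        (((isReal_mul_conj (linFactor q₀)).pow n).commute T).eq]
    rwa [e3] at h2

/-! ### Möbius transforms of bounded functions -/

/-- Invariance under `w ↦ (w - c) (1 - w \bar c)⁻¹`. -/
lemma norm_sub_le_norm_one_sub_mul_star {w c : ℍ[ℝ]} (hw : ‖w‖ ≤ 1) (hc : ‖c‖ ≤ 1) :
    ‖w - c‖ ≤ ‖1 - w * star c‖ := by
  have e : Quaternion.normSq (1 - w * star c) =
      Quaternion.normSq (w - c) + (1 - Quaternion.normSq w) * (1 - Quaternion.normSq c) := by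
    simp only [Quaternion.normSq_def', Quaternion.re_sub, Quaternion.imI_sub, Quaternion.imJ_sub,
      Quaternion.imK_sub, Quaternion.re_mul, Quaternion.imI_mul, Quaternion.imJ_mul,
      Quaternion.imK_mul, Quaternion.re_star, Quaternion.imI_star, Quaternion.imJ_star,
      Quaternion.imK_star, Quaternion.re_one, Quaternion.imI_one, Quaternion.imJ_one,
      Quaternion.imK_one]
    ring
  simp only [Quaternion.normSq_eq_norm_mul_self] at e
  have h1 : 0 ≤ 1 - ‖w‖ * ‖w‖ := by nlinarith [norm_nonneg w]
  have h2 : 0 ≤ 1 - ‖c‖ * ‖c‖ := by nlinarith [norm_nonneg c]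
  exact abs_le_of_sq_le_sq' (by nlinarith [mul_nonneg h1 h2]) (norm_nonneg _) |>.2

/-- The regular Möbius transform of a bounded function. -/
lemma exists_inverse_norm_le {φ : PowerSeries ℍ[ℝ]} (h : Conv φ)
    (hφ : ∀ q, ‖q‖ < 1 → ‖ev φ q‖ ≤ 1) {c : ℍ[ℝ]} (hc : ‖c‖ < 1) :
    ∃ κ, Conv κ ∧ (1 - PowerSeries.C (star c) * φ) * κ = 1 ∧
      κ * (1 - PowerSeries.C (star c) * φ) = 1 ∧
      ∀ q, ‖q‖ < 1 → ‖ev ((φ - PowerSeries.C c) * κ) q‖ ≤ 1 := by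
  obtain ⟨κ, hκ, h1, h2⟩ := exists_inverse_one_sub ((conv_C (star c)).mul h) hc fun q hq => by
    simpa [Quaternion.norm_star] using
      norm_ev_mul_le (conv_C (star c)) h hq fun u hu => hφ u (hu ▸ hq)
  have hk := h.mul (conv_C (star c))
  obtain ⟨μ, hμ, h3, h4⟩ := exists_inverse_one_sub hk hc fun q hq => by
    rw [ev_mul_C h _ hq, norm_mul, Quaternion.norm_star]
    exact mul_le_of_le_one_left (norm_nonneg _) (hφ q hq)
  refine ⟨κ, hκ, h1, h2, fun q hq => ?_⟩
  have hd := h.sub (conv_C c)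
  have ha := conv_one.sub hk
  have hcc : PowerSeries.C (star c) * PowerSeries.C c = PowerSeries.C c * PowerSeries.C (star c) := by
    rw [← map_mul, ← map_mul, star_comm_self']
  -- This rewrites (φ - c) * (1 - c̄ * φ)^{-*} as (1 - φ * c̄)^{-*} * (φ - c). With c̄ on the right,
  -- numerator and denominator both evaluate pointwise in φ(u). The terms match because c c̄ is
  -- real, hence central.
  have e0 : (1 - φ * PowerSeries.C (star c)) * (φ - PowerSeries.C c) =
      (φ - PowerSeries.C c) * (1 - PowerSeries.C (star c) * φ) := by
    have hr : IsReal (PowerSeries.C c * PowerSeries.C (star c)) := by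
      rw [← conj_C]; exact isReal_mul_conj _
    have e := (hr.commute φ).eq
    simp only [sub_mul, mul_sub, one_mul, mul_one, mul_assoc, hcc]
    rw [← mul_assoc (PowerSeries.C c), e]
    abel
  have e : (1 - φ * PowerSeries.C (star c)) * ((φ - PowerSeries.C c) * κ) =
      φ - PowerSeries.C c := by
    rw [← mul_assoc, e0, mul_assoc, h1, mul_one]
  refine norm_ev_le_of_mul_eq ha (hd.mul hκ) hd e hq (ev_symm_ne_zero ha hμ h3 h4 hq)
    fun u hu => ?_
  have hu1 : ‖u‖ < 1 := hu ▸ hq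
  rw [one_mul, ev_sub h (conv_C c) hu1, ev_sub conv_one hk hu1, ev_mul_C h _ hu1, ev_C, ev_one]
  exact norm_sub_le_norm_one_sub_mul_star (hφ u hu1) hc.le

/-! ### Symmetrizations of the factors and of the Möbius map -/

lemma ev_reflFactor_symm {q₀ q : ℍ[ℝ]} (hq : ‖q‖ < 1) :
    ev (reflFactor q₀ * conj (reflFactor q₀)) q =
      (1 - q * (q₀.re : ℍ[ℝ])) ^ 2 + (q * (‖q₀.im‖ : ℍ[ℝ])) ^ 2 := by
  have hX : ∀ φ : PowerSeries ℍ[ℝ], φ * PowerSeries.X = PowerSeries.X * φ := fun φ =>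
    PowerSeries.X_mul.symm
  -- As X is central, T = 1 - 2x₀ X + (x₀² + y₀²) X², which evaluates term by term.
  have e : reflFactor q₀ * conj (reflFactor q₀) =
      1 - PowerSeries.X * PowerSeries.C (star q₀ + q₀) +
        PowerSeries.X * PowerSeries.X * PowerSeries.C (star q₀ * q₀) := by
    rw [conj_reflFactor, reflFactor, reflFactor, star_star, map_add, map_mul]
    simp only [sub_mul, mul_sub, one_mul, mul_one, mul_add, mul_assoc]
    rw [← mul_assoc (PowerSeries.C (star q₀)) PowerSeries.X, hX, mul_assoc]
    abel
  have hXX := conv_X.mul conv_X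
  rw [e, ev_add (conv_one.sub (conv_X.mul (conv_C _))) (hXX.mul (conv_C _)) hq,
    ev_sub conv_one (conv_X.mul (conv_C _)) hq, ev_mul_C conv_X _ hq, ev_mul_C hXX _ hq, ev_one,
    ev_mul_of_commute conv_X conv_X hq (by rw [ev_X]), ev_X]
  have h1 : star q₀ + q₀ = ((2 * q₀.re : ℝ) : ℍ[ℝ]) := by
    rw [add_comm, Quaternion.self_add_star]; push_cast; rfl
  have h2 : star q₀ * q₀ = ((q₀.re ^ 2 + ‖q₀.im‖ ^ 2 : ℝ) : ℍ[ℝ]) := by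
    rw [Quaternion.star_mul_self, sq ‖q₀.im‖, ← Quaternion.normSq_eq_norm_mul_self,
      Quaternion.normSq_def', Quaternion.normSq_def']
    simp [add_assoc]
  rw [h1, h2]
  simp only [← Quaternion.coe_commutes, Quaternion.coe_mul_eq_smul, sq, sub_mul, mul_sub, one_mul,
    mul_one, smul_mul_smul_comm]
  module

lemma rep_mobius {q₀ : ℍ[ℝ]} {κ : PowerSeries ℍ[ℝ]} (hκ : Conv κ) (h1 : reflFactor q₀ * κ = 1)
    (h2 : κ * reflFactor q₀ = 1) : Rep (mobius q₀) (linFactor q₀ * κ) :=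
  ⟨(rep_linFactor q₀).1.mul hκ, fun _ hq =>
    (rep_linFactor q₀).rightQuot_eq (rep_reflFactor q₀) hκ h1 h2 hq⟩

/-- This is 𝓜^s = S/T with the denominator cleared; κ^s is the inverse of T and is central. -/
lemma ev_mul_symmetrization_mobius {q₀ : ℍ[ℝ]} (hq₀ : ‖q₀‖ < 1) {q : ℍ[ℝ]} (hq : ‖q‖ < 1) :
    ev (reflFactor q₀ * conj (reflFactor q₀)) q * symmetrization (mobius q₀) q =
      ev (linFactor q₀ * conj (linFactor q₀)) q := by
  obtain ⟨κ, hκ, h1, h2⟩ := exists_inverse_reflFactor hq₀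
  have hr := (rep_reflFactor q₀).1
  have hm := rep_mobius hκ h1 h2
  rw [hm.symmetrization_eq,
    ← (isReal_mul_conj (reflFactor q₀)).ev_mul (hr.mul hr.conj) (hm.1.mul hm.1.conj) hq]
  congr 1
  rw [conj_mul, mul_assoc (linFactor q₀), ← mul_assoc,
    ((isReal_mul_conj (reflFactor q₀)).commute _).eq]
  calc linFactor q₀ * (reflFactor q₀ * conj (reflFactor q₀)) * (κ * (conj κ * conj (linFactor q₀)))
      = linFactor q₀ * (reflFactor q₀ * conj (reflFactor q₀) * (κ * conj κ)) *
          conj (linFactor q₀) := by simp only [mul_assoc]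
    _ = _ := by rw [symm_mul_symm_of_inverse h1 h2, mul_one]

end SliceRegularBall

end

open SliceRegularBall
-- The four estimates
theorem mainTheorem7 (f : ℍ[ℝ] → ℍ[ℝ]) (hf : SliceRegular f)
    (hmaps : Set.MapsTo f unitBall unitBall)
    (q₀ : ℍ[ℝ]) (hq₀ : q₀ ∈ unitBall) (x₀ y₀ : ℝ) (hx₀ : x₀ = q₀.re) (hy₀ : y₀ = ‖q₀.im‖)
    (n : ℕ) (hn : 1 ≤ n)
    (hA : ∀ m : ℕ, 1 ≤ m → m ≤ 2 * n - 1 → sphericalCoeff f q₀ m = 0) :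
    (∀ q ∈ unitBall,
      ‖rightQuot (fun p => f p - f q₀) (schwarzDenom f q₀) q‖
          ≤ ‖symmetrization (mobius q₀) q‖ ^ n ∧
      ‖rightQuot (iterDiffQuot q₀ n f) (schwarzDenom f q₀) q‖
          ≤ ‖(1 - q * (x₀ : ℍ[ℝ])) ^ 2 + (q * (y₀ : ℍ[ℝ])) ^ 2‖ ^ (-(n : ℤ))) ∧
    (sphericalCoeff f q₀ (2 * n) = 0 → ∀ q ∈ unitBall,
      ‖rightQuot (fun p => f p - f q₀) (schwarzDenom f q₀) q‖
          ≤ ‖symmetrization (mobius q₀) q‖ ^ n * ‖mobius q₀ q‖ ∧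
      ‖rightQuot (diffQuot q₀ (iterDiffQuot q₀ n f)) (schwarzDenom f q₀) q‖
          ≤ ‖(1 - q * (x₀ : ℍ[ℝ])) ^ 2 + (q * (y₀ : ℍ[ℝ])) ^ 2‖ ^ (-(n : ℤ))
            * ‖regRecip (fun p => 1 - p * star q₀) q‖) := by
  -- With n = k + 1 the bound 2n - 1 becomes 2k + 1, the form used in `Rep.iterDiffQuot`.
  obtain ⟨k, rfl⟩ : ∃ k, n = k + 1 := ⟨n - 1, by omega⟩
  subst hx₀ hy₀
  obtain ⟨φ, hφ⟩ := hf.exists_rep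
  have hb : ∀ q, ‖q‖ < 1 → ‖ev φ q‖ ≤ 1 := fun q hq => by
    rw [← hφ.2 q hq]; exact (mem_unitBall.mp (hmaps (mem_unitBall.mpr hq))).le
  have hc : ‖f q₀‖ < 1 := mem_unitBall.mp (hmaps hq₀)
  replace hq₀ := mem_unitBall.mp hq₀
  obtain ⟨Φ, hΦ, eΦ⟩ := hφ.iterDiffQuot hq₀ k fun m h1 h2 => hA m h1 (by omega)
  obtain ⟨η, hη, hη1, hη2, hF⟩ := exists_inverse_norm_le hφ.1 hb hc
  obtain ⟨κ, hκ, hκ1, hκ2⟩ := exists_inverse_reflFactor hq₀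
  have hden : Rep (schwarzDenom f q₀) (1 - PowerSeries.C (star (f q₀)) * φ) :=
    Rep.one.sub ((Rep.const _).regMul hφ)
  have hp := (rep_linFactor q₀).1
  have hr := (rep_reflFactor q₀).1
  have hm := rep_mobius hκ hκ1 hκ2
  have hS := hp.mul hp.conj
  have hT := hr.mul hr.conj
  have hSr := isReal_mul_conj (linFactor q₀)
  have hTr := isReal_mul_conj (reflFactor q₀)
  have hms := fun q hq => congrArg norm (ev_mul_symmetrization_mobius hq₀ (q := q) hq)
  have ht := fun q hq => norm_pos_iff.mpr (ev_symm_ne_zero hr hκ hκ1 hκ2 (q := q) hq)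
  have hrefl := fun q hq => ev_reflFactor_symm (q₀ := q₀) (q := q) hq
  set S := linFactor q₀ * conj (linFactor q₀)
  set T := reflFactor q₀ * conj (reflFactor q₀)
  set n := k + 1
  have eF : (φ - PowerSeries.C (f q₀)) * η = S ^ n * (Φ * η) := by
    rw [eΦ, add_sub_cancel_left, mul_assoc]
  rw [eF] at hF
  have evF : ∀ q, ‖q‖ < 1 → ‖rightQuot (fun p => f p - f q₀) (schwarzDenom f q₀) q‖ =
      ‖ev S q‖ ^ n * ‖ev (Φ * η) q‖ := fun q hq => by
    rw [(hφ.sub (Rep.const _)).rightQuot_eq hden hη hη1 hη2 hq, eF,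
      (hSr.pow n).ev_mul (hS.pow n) (hΦ.1.mul hη) hq, hSr.ev_pow hS hq, norm_mul, norm_pow]
  have hTev : ∀ {χ : PowerSeries ℍ[ℝ]}, Conv χ → ∀ {q}, ‖q‖ < 1 →
      ‖ev (T ^ n * χ) q‖ = ‖ev T q‖ ^ n * ‖ev χ q‖ := fun hχ q hq => by
    rw [(hTr.pow n).ev_mul (hT.pow n) hχ hq, hTr.ev_pow hT hq, norm_mul, norm_pow]
  have hle := fun q hq => norm_ev_reflFactor_symm_pow_mul_le hq₀ n (hΦ.1.mul hη) hF (q := q) hq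
  refine ⟨fun q hq => ?_, fun h2n q hq => ?_⟩
  · rw [mem_unitBall] at hq
    have h1 := hle q hq
    rw [hTev (hΦ.1.mul hη) hq] at h1
    refine ⟨?_, ?_⟩
    · rw [evF q hq, ← hms q hq, norm_mul, mul_pow]
      calc _ = ‖symmetrization (mobius q₀) q‖ ^ n * (‖ev T q‖ ^ n * ‖ev (Φ * η) q‖) := by ring
        _ ≤ _ := mul_le_of_le_one_right (by positivity) h1
    · rw [hΦ.rightQuot_eq hden hη hη1 hη2 hq, ← hrefl q hq, zpow_neg, zpow_natCast,
        ← one_div, le_div_iff₀ (pow_pos (ht q hq) n), mul_comm]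
      exact h1
  · rw [mem_unitBall] at hq
    obtain ⟨Ψ, hΨ, eΨ⟩ := hΦ.diffQuot hq₀
    rw [sphericalCoeff_two_mul] at h2n
    rw [h2n, map_zero, zero_add] at eΨ
    have hχ := hΨ.1.mul hη
    -- Tⁿ is central, so q - q₀ comes to the front, ready for one more Schwarz step.
    have e1 : T ^ n * (Φ * η) = linFactor q₀ * (T ^ n * (Ψ * η)) := by
      rw [eΨ, mul_assoc, ← mul_assoc, ((hTr.pow n).commute _).eq, mul_assoc]
    have h1 : ∀ q, ‖q‖ < 1 → ‖ev (reflFactor q₀ * (T ^ n * (Ψ * η))) q‖ ≤ 1 := fun q hq =>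
      norm_ev_reflFactor_mul_le hq₀ ((hT.pow n).mul hχ) (fun q hq => e1 ▸ hle q hq) hq
    have hY := hr.mul ((hT.pow n).mul hχ)
    refine ⟨?_, ?_⟩
    -- Since 𝓜 * (1 - q q̄₀) = q - q₀, the product Tⁿ * Φ * η is 𝓜 times a function bounded by 1.
    · have e2 : linFactor q₀ * κ * (reflFactor q₀ * (T ^ n * (Ψ * η))) = T ^ n * (Φ * η) := by
        rw [e1, mul_assoc, ← mul_assoc κ, hκ2, one_mul]
      have h2 := norm_ev_mul_le hm.1 hY hq fun u hu => h1 u (hu ▸ hq)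
      rw [e2, hTev (hΦ.1.mul hη) hq, mul_one, ← hm.2 q hq] at h2
      rw [evF q hq, ← hms q hq, norm_mul, mul_pow]
      calc _ = ‖symmetrization (mobius q₀) q‖ ^ n * (‖ev T q‖ ^ n * ‖ev (Φ * η) q‖) := by ring
        _ ≤ _ := mul_le_mul_of_nonneg_left h2 (by positivity)
    · have e2 : κ * (reflFactor q₀ * (T ^ n * (Ψ * η))) = T ^ n * (Ψ * η) := by
        rw [← mul_assoc, hκ2, one_mul]
      have h2 := norm_ev_mul_le hκ hY hq fun u hu => h1 u (hu ▸ hq)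
      rw [e2, hTev hχ hq, mul_one, ← (rep_reflFactor q₀).regRecip_eq hκ hκ1 hκ2 hq] at h2
      rw [hΨ.rightQuot_eq hden hη hη1 hη2 hq, ← hrefl q hq, zpow_neg, zpow_natCast,
        inv_mul_eq_div, le_div_iff₀ (pow_pos (ht q hq) n), mul_comm]
      exact h2
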